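/- Let $\mathfrak{A}=\left(\frac{-3,-1}{\mathbb{Q}}\right)$ be the rational quaternion algebra with standard generators $\mathtt{q},\mathtt{p}$ satisfying $\mathtt{q}^2=-3$, $\mathtt{p}^2=-1$, $\mathtt{p}\mathtt{q}=-\mathtt{q}\mathtt{p}$, let $\mathtt{r}=\frac12(1+\mathtt{q})$, and let $G_D=\langle \mathtt{r},\mathtt{p}\rangle\subseteq\mathfrak{A}^*$ be the dicyclic group. For an algebraic (possibly infinite) extension $E/\mathbb{Q}_\ell$, $\ell$ a prime, let $\mathcal{O}_E$ be the integral closure of $\mathbb{Z}_\ell$ in $E$, and let $e(E/\mathbb{Q}_\ell)\in\mathbb{N}\cup\{\infty\}$ be the ramification index, i.e. the index of the value group of $\mathbb{Q}_\ell$ in that of $E$. If $E$ splits $\mathfrak{A}$, i.e. $\mathfrak{A}_E=E\otimes_{\mathbb{Q}}\mathfrak{A}\cong\mathbb{M}_2(E)$, let $\rho:G_D\to\mathrm{GL}_2(E)$ be the representation obtained from the inclusion $G_D\subseteq\mathfrak{A}^*\subseteq\mathfrak{A}_E^*$ and any such isomorphism, and let $\mathrm{IF}_\rho^{G_D}(E)$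 be the set of $\mathrm{GL}_2(\mathcal{O}_E)$-conjugacy classes of homomorphisms $G_D\to\mathrm{GL}_2(\mathcal{O}_E)$ that are $\mathrm{GL}_2(E)$-conjugates of $\rho$. (1) Let $E$ be a Galois extension of $\mathbb{Q}_3$ containing a quadratic extension of $\mathbb{Q}_3$. Then $E$ splits $\mathfrak{A}$, and for every choice of the isomorphism $\mathfrak{A}_E\cong\mathbb{M}_2(E)$ the set $\mathrm{IF}_\rho^{G_D}(E)$ has exactly $e(E/\mathbb{Q}_3)+1$ elements if $\sqrt2\in E$ (that is, it is infinite if $e(E/\mathbb{Q}_3)=\infty$), and is a singleton if $\sqrt2\notin E$. (2) Let $\ell\neq3$ be a prime and let $E$ be any algebraic extension of $\mathbb{Q}_\ell$. Then $E$ splits $\mathfrak{A}$, and for every choice of the isomorphism $\mathfrak{A}_E\cong\mathbb{M}_2(E)$ the set $\mathrm{IF}_\rho^{G_D}(E)$ is a singleton. -/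

import Mathlib

open scoped Quaternion TensorProduct

/-! ### The dicyclic group -/

/-- The unit `r = (1 + q) / 2` of the rational quaternion algebra `(-3, -1 / ℚ)`, where `q` and `p`
are the standard generators: `q ^ 2 = -3`, `p ^ 2 = -1` and `p * q = - q * p`. The four coordinates
are those with respect to the basis `1, q, p, q * p`. -/
def dicyclicR : (ℍ[ℚ, -3, -1])ˣ where
  val := ⟨1 / 2, 1 / 2, 0, 0⟩
  inv := ⟨1 / 2, -1 / 2, 0, 0⟩
  val_inv := by ext <;> norm_num
  inv_val := by ext <;> norm_num

/-- The standard generator `p` of `(-3, -1 / ℚ)` with `p ^ 2 = -1`, as a unit. -/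
def dicyclicP : (ℍ[ℚ, -3, -1])ˣ where
  val := ⟨0, 0, 1, 0⟩
  inv := ⟨0, 0, -1, 0⟩
  val_inv := by ext <;> norm_num
  inv_val := by ext <;> norm_num

/-- The dicyclic group `G_D = ⟨r, p⟩`, a group of invertible quaternions. -/
def dicyclicGroup : Subgroup (ℍ[ℚ, -3, -1])ˣ :=
  Subgroup.closure {dicyclicR, dicyclicP}

/-- The representation `G_D → GL₂(E)` obtained by extension of scalars to `E`, once the quaternion
algebra over `E` has been identified with the matrix algebra by means of `φ`. -/
noncomputable def dicyclicRep {E : Type*} [Field E] [Algebra ℚ E]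
    (φ : (E ⊗[ℚ] ℍ[ℚ, -3, -1]) ≃ₐ[E] Matrix (Fin 2) (Fin 2) E) :
    dicyclicGroup →* GL (Fin 2) E :=
  (Units.map (φ.toAlgHom.toMonoidHom.comp
    (Algebra.TensorProduct.includeRight :
      ℍ[ℚ, -3, -1] →ₐ[ℚ] E ⊗[ℚ] ℍ[ℚ, -3, -1]).toMonoidHom)).comp dicyclicGroup.subtype

/-! ### Integral forms of a representation -/

section IntegralForms

variable {G F : Type*} [Group G] [Field F] {n : ℕ}

/-- The integral representations `G → GL_n(O)` that are `GL_n(F)`-conjugates of `ρ`. -/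
def IntegralRep (O : Subring F) (ρ : G →* GL (Fin n) F) :=
  {σ : G →* GL (Fin n) O //
    ∃ g : GL (Fin n) F, ∀ x : G,
      Matrix.GeneralLinearGroup.map O.subtype (σ x) = g * ρ x * g⁻¹}

/-- Conjugacy under `GL_n(O)`. -/
def integralRepSetoid (O : Subring F) (ρ : G →* GL (Fin n) F) : Setoid (IntegralRep O ρ) where
  r σ τ := ∃ h : GL (Fin n) O, ∀ x : G, τ.1 x = h * σ.1 x * h⁻¹
  iseqv :=
    { refl := fun _ => ⟨1, fun _ => by simp⟩
      symm := by
        rintro σ τ ⟨h, hh⟩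
        exact ⟨h⁻¹, fun x => by rw [hh x]; group⟩
      trans := by
        rintro σ τ υ ⟨h, hh⟩ ⟨k, hk⟩
        exact ⟨k * h, fun x => by rw [hk x, hh x]; group⟩ }

/-- The set of integral forms of `ρ`: the `GL_n(O)`-conjugacy classes of integral representations
that are `GL_n(F)`-conjugates of `ρ`. -/
def IntegralForms (O : Subring F) (ρ : G →* GL (Fin n) F) :=
  Quotient (integralRepSetoid O ρ)

end IntegralForms

/-! ### Algebraic extensions of `ℚ_p` -/

section Local

variable (p : ℕ) [Fact p.Prime] (E : Type*) [Field E] [Algebra ℚ_[p] E]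

/-- The ring of integers of an algebraic extension `E` of `ℚ_p`: the elements of `E` that are
integral over `ℤ_p`. -/
noncomputable def localIntegers : Subring E :=
  letI : Algebra ℤ_[p] E := ((algebraMap ℚ_[p] E).comp (algebraMap ℤ_[p] ℚ_[p])).toAlgebra
  (integralClosure ℤ_[p] E).toSubring

/-- The ramification index `e(E / ℚ_p)` of an algebraic extension `E` of `ℚ_p`: the index of the
value group of `ℚ_p` in that of `E`. As the value group of `E` is `Eˣ / O_Eˣ`, this is the number of
elements of `Eˣ / (O_Eˣ ℚ_pˣ)`. It may be infinite if `E / ℚ_p` is infinite. -/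
noncomputable def localRamificationIndex : ℕ∞ :=
  ENat.card (Eˣ ⧸
    ((Units.map (localIntegers p E).subtype.toMonoidHom).range ⊔
      (Units.map (algebraMap ℚ_[p] E).toMonoidHom).range))

end Local

/-! Write `O` for the ring of integers of `E`. An integral form of `ρ` amounts to a pair of matrices
`(R, P)` over `O` satisfying the relations of `r` and `p`, up to `GL₂(O)`: by dimension, a pair over
`E` identifies `𝔄_E` with the matrix algebra, and by Skolem–Noether all such identifications are
conjugate (`DicyclicPair.exists_integralRep`). One integral pair thus yields both the splitting and
the existence of a form.

Uniqueness. Two forms are intertwined by an invertible matrix over `E`. As `O` is a valuation ring,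
this matrix can be scaled to a primitive integral `N`. If `det N` is not a unit, the kernel of `N`
over the residue field is a common eigenline of `R` and `P`, which forces residue characteristic `3`
and a square root of `-1` there (`integralRepSetoid_of_residueField`). So the form is unique if `ℓ ≠
3`. For `ℓ = 3` the residual root would lift to `E` by Krasner's lemma, and since `-2` is a square
in `ℚ_3`, the fields containing `√-1` are those containing `√2`.

Counting. Let `ℓ = 3` and `s = √-1 ∈ E`. As `2` is a unit, `P` can be brought to `diag(s, -s)`; then
`q = 2R - 1` is antidiagonal with entries `β`, `γ` and `βγ = -3`. The remaining conjugations change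
`β` by a unit, so forms correspond to the absolute values of `E` in `[1/3, 1]`. The interval `(1/3,
1]` represents each class of the value group modulo that of `ℚ_3` once, which gives `e`, and the
endpoint `1/3` gives one more. -/

/-- A pair of `2 × 2` matrices satisfying the defining relations of the generators `r` and `p` of
the order `ℤ[r, p]` of the quaternion algebra `(-3, -1 / ℚ)`. -/
structure DicyclicPair {A : Type*} [CommRing A] (R P : Matrix (Fin 2) (Fin 2) A) : Prop where
  r_sq : R * R = R - 1
  p_sq : P * P = -1
  p_mul_r : P * R = (1 - R) * P

/-! ### Pairs as representations of the quaternion algebra -/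

namespace DicyclicPair

section CommRing

variable {A B : Type*} [CommRing A] [CommRing B] {R P : Matrix (Fin 2) (Fin 2) A}

theorem map (h : DicyclicPair R P) (f : A →+* B) :
    DicyclicPair (f.mapMatrix R) (f.mapMatrix P) where
  r_sq := by rw [← map_mul, h.r_sq, map_sub, map_one]
  p_sq := by rw [← map_mul, h.p_sq, map_neg, map_one]
  p_mul_r := by rw [← map_mul, h.p_mul_r, map_mul, map_sub, map_one]

theorem of_map {f : A →+* B} (hf : Function.Injective f)
    (h : DicyclicPair (f.mapMatrix R) (f.mapMatrix P)) : DicyclicPair R P := by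
  have hf' : Function.Injective (f.mapMatrix (m := Fin 2)) := Matrix.map_injective hf
  refine ⟨hf' ?_, hf' ?_, hf' ?_⟩
  · rw [map_mul, h.r_sq, map_sub, map_one]
  · rw [map_mul, h.p_sq, map_neg, map_one]
  · rw [map_mul, h.p_mul_r, map_mul, map_sub, map_one]

theorem conj (h : DicyclicPair R P) (g : GL (Fin 2) A) :
    DicyclicPair (g.1 * R * (g⁻¹).1) (g.1 * P * (g⁻¹).1) := by
  have e : ∀ X Y : Matrix (Fin 2) (Fin 2) A,
      g.1 * X * (g⁻¹).1 * (g.1 * Y * (g⁻¹).1) = g.1 * (X * Y) * (g⁻¹).1 := by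
    intro X Y
    simp only [Matrix.mul_assoc, Units.inv_mul_cancel_left]
  have e1 : g.1 * 1 * (g⁻¹).1 = 1 := by simp
  refine ⟨?_, ?_, ?_⟩
  · rw [e, h.r_sq, mul_sub, sub_mul, e1]
  · rw [e, h.p_sq, mul_neg, neg_mul, e1]
  · rw [e, h.p_mul_r, ← e, mul_sub, sub_mul, e1]

theorem isUnit_r (h : DicyclicPair R P) : IsUnit R :=
  .of_mul_eq_one (1 - R) (by rw [mul_sub, h.r_sq]; simp)

theorem isUnit_p (h : DicyclicPair R P) : IsUnit P :=
  .of_mul_eq_one (-P) (by rw [mul_neg, h.p_sq]; simp)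

/-- The basis `1, q, p, q * p` given by a pair, where `q = 2 * r - 1`. -/
def basis [Algebra ℚ A] (h : DicyclicPair R P) :
    QuaternionAlgebra.Basis (Matrix (Fin 2) (Fin 2) A) (-3 : ℚ) 0 (-1) where
  i := 2 * R - 1
  j := P
  k := (2 * R - 1) * P
  i_mul_i := by
    have : (2 * R - 1) * (2 * R - 1) = 4 * (R * R) - 4 * R + 1 := by noncomm_ring
    rw [this, h.r_sq, mul_sub, zero_smul, add_zero, neg_smul, ofNat_smul_eq_nsmul, nsmul_one]
    norm_num
  j_mul_j := by rw [h.p_sq]; simp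
  i_mul_j := rfl
  j_mul_i := by
    have : P * (2 * R - 1) = 2 * (P * R) - P := by noncomm_ring
    rw [this, h.p_mul_r, zero_smul]
    noncomm_ring

/-- The representation of the quaternion algebra given by a pair. -/
def lift [Algebra ℚ A] (h : DicyclicPair R P) :
    ℍ[ℚ, -3, -1] →ₐ[ℚ] Matrix (Fin 2) (Fin 2) A :=
  h.basis.liftHom

theorem lift_r [Algebra ℚ A] (h : DicyclicPair R P) : h.lift dicyclicR.1 = R := by
  have : (2 : Matrix (Fin 2) (Fin 2) A) * R = (2 : ℚ) • R := by
    rw [ofNat_smul_eq_nsmul, nsmul_eq_mul]; norm_num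
  simp only [lift, QuaternionAlgebra.Basis.liftHom_apply, QuaternionAlgebra.Basis.lift, dicyclicR,
    basis, this, smul_sub, smul_smul, Algebra.algebraMap_eq_smul_one]
  norm_num

theorem lift_p [Algebra ℚ A] (h : DicyclicPair R P) : h.lift dicyclicP.1 = P := by
  simp [lift, QuaternionAlgebra.Basis.lift, dicyclicP, basis]

end CommRing

section Field

variable {E : Type*} [Field E] [Algebra ℚ E] {R P : Matrix (Fin 2) (Fin 2) E}

/-- The `E`-linear extension of `DicyclicPair.lift`. -/
noncomputable def liftTensor (h : DicyclicPair R P) :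
    (E ⊗[ℚ] ℍ[ℚ, -3, -1]) →ₐ[E] Matrix (Fin 2) (Fin 2) E :=
  Algebra.TensorProduct.lift (Algebra.ofId E _) h.lift fun x y =>
    show Commute (Algebra.ofId E (Matrix (Fin 2) (Fin 2) E) x) (h.lift y) from
      Algebra.commutes x _

theorem liftTensor_one_tmul (h : DicyclicPair R P) (x : ℍ[ℚ, -3, -1]) :
    h.liftTensor (1 ⊗ₜ x) = h.lift x := by
  rw [liftTensor, Algebra.TensorProduct.lift_tmul, map_one, one_mul]

/-- A scalar matrix commutes with `q`, whereas `P` anticommutes with it; so `c q = -c q`, and `q ≠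
0` because `q ^ 2 = -3`. -/
theorem eq_zero_of_smul_eq_smul_one (h : DicyclicPair R P) {a c : E} (hac : a • P = c • 1) :
    a = 0 ∧ c = 0 := by
  have : CharZero E := algebraRat.charZero E
  have hq := h.basis.i_mul_i
  have hpq := h.basis.j_mul_i
  rw [zero_smul, zero_sub, ← h.basis.i_mul_j] at hpq
  rw [zero_smul, add_zero] at hq
  have hc : c • h.basis.i = 0 := by
    have h1 : a • (P * h.basis.i) = c • h.basis.i := by
      rw [← Matrix.smul_mul, hac, Matrix.smul_mul, one_mul]
    have h2 : a • (h.basis.i * P) = c • h.basis.i := by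
      rw [← Matrix.mul_smul, hac, Matrix.mul_smul, mul_one]
    have h3 : P * h.basis.i = -(h.basis.i * P) := hpq
    rw [h3, smul_neg, h2] at h1
    have : (2 * c) • h.basis.i = 0 := by
      rw [two_mul, add_smul]; nth_rewrite 1 [← h1]; simp
    rw [mul_smul] at this
    exact (smul_eq_zero_iff_right two_ne_zero).1 this
  have hq0 : h.basis.i ≠ 0 := by
    intro h0
    rw [h0, mul_zero] at hq
    have := congr($hq 0 0)
    simp at this
  have hc0 : c = 0 := (smul_eq_zero.1 hc).resolve_right hq0
  refine ⟨?_, hc0⟩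
  rw [hc0, zero_smul] at hac
  refine (smul_eq_zero.1 hac).resolve_right fun h0 => ?_
  have := h.p_sq
  rw [h0, mul_zero] at this
  have := congr($this 0 0)
  simp at this

/-- Multiply the relation by `P` on the right and on the left. The sum of the results is `2 (a P -
c)` and the difference is `2 (b q P - d q)`; after multiplication by `q` the latter also relates `P`
to a scalar. -/
theorem eq_zero_of_combination_eq_zero (h : DicyclicPair R P) {a b c d : E}
    (habcd : a • 1 + b • h.basis.i + c • h.basis.j + d • h.basis.k = 0) :
    a = 0 ∧ b = 0 ∧ c = 0 ∧ d = 0 := by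
  have : CharZero E := algebraRat.charZero E
  have hq := h.basis.i_mul_i
  have hpq := h.basis.j_mul_i
  have hp := h.basis.j_mul_j
  have hk := h.basis.i_mul_j
  have hjk := h.basis.j_mul_k
  have hkj := h.basis.k_mul_j
  have hik := h.basis.i_mul_k
  simp only [zero_smul, zero_sub, add_zero] at hq hpq hjk hkj hik
  have h1 := congr($habcd * h.basis.j)
  have h2 := congr(h.basis.j * $habcd)
  simp only [add_mul, mul_add, Matrix.smul_mul, Matrix.mul_smul, one_mul, mul_one, hp, hpq, hk, hjk,
    hkj, zero_mul, mul_zero] at h1 h2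
  have h3 : (2 : E) • (a • h.basis.j - c • 1) = 0 := by
    have := congr($h1 + $h2)
    simp only [neg_smul, one_smul, smul_neg, add_zero] at this
    rw [← this]; module
  have h4 : (2 : E) • (b • h.basis.k - d • h.basis.i) = 0 := by
    have := congr($h1 - $h2)
    simp only [neg_smul, one_smul, smul_neg, sub_zero] at this
    rw [← this]; module
  replace h3 := (smul_eq_zero_iff_right two_ne_zero).1 h3
  replace h4 := (smul_eq_zero_iff_right two_ne_zero).1 h4
  obtain ⟨ha, hc⟩ := h.eq_zero_of_smul_eq_smul_one (sub_eq_zero.1 h3)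
  have h5 := congr(h.basis.i * $h4)
  simp only [mul_sub, Matrix.mul_smul, hik, hq, mul_zero] at h5
  have h6 : (-3 : E) • (b • P - d • (1 : Matrix (Fin 2) (Fin 2) E)) = 0 := by
    have e : ∀ X : Matrix (Fin 2) (Fin 2) E, (-3 : ℚ) • X = (-3 : E) • X := by
      intro X; ext; simp [Algebra.smul_def]
    rw [e, e] at h5
    rw [← h5, smul_sub, smul_comm b, smul_comm d]; rfl
  have h7 : (-3 : E) ≠ 0 := by norm_num
  obtain ⟨hb, hd⟩ := h.eq_zero_of_smul_eq_smul_one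
    (sub_eq_zero.1 ((smul_eq_zero_iff_right h7).1 h6))
  exact ⟨ha, hb, hc, hd⟩

/-- The images of `1, q, p, q * p` are independent, and both algebras have dimension `4`. -/
theorem bijective_liftTensor (h : DicyclicPair R P) : Function.Bijective h.liftTensor := by
  have hfin : Module.finrank E (E ⊗[ℚ] ℍ[ℚ, -3, -1]) =
      Module.finrank E (Matrix (Fin 2) (Fin 2) E) := by
    rw [Module.finrank_baseChange, QuaternionAlgebra.finrank_eq_four, Module.finrank_matrix]
    simp
  have hinj : Function.Injective h.liftTensor := by
    rw [injective_iff_map_eq_zero]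
    intro x hx
    let B := (QuaternionAlgebra.basisOneIJK (-3 : ℚ) 0 (-1)).baseChange E
    have hxs := B.sum_repr x
    rw [Fin.sum_univ_four] at hxs
    have key : ∀ i, h.liftTensor (B i) = h.lift (QuaternionAlgebra.basisOneIJK (-3 : ℚ) 0 (-1) i) := by
      intro i
      simp only [B, Module.Basis.baseChange_apply, liftTensor_one_tmul]
    rw [← hxs] at hx
    simp only [map_add, map_smul, key] at hx
    have e0 : h.lift (QuaternionAlgebra.basisOneIJK (-3 : ℚ) 0 (-1) 0) = 1 := by
      simp [lift, QuaternionAlgebra.Basis.lift, QuaternionAlgebra.basisOneIJK]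
    have e1 : h.lift (QuaternionAlgebra.basisOneIJK (-3 : ℚ) 0 (-1) 1) = h.basis.i := by
      simp [lift, QuaternionAlgebra.Basis.lift, QuaternionAlgebra.basisOneIJK]
    have e2 : h.lift (QuaternionAlgebra.basisOneIJK (-3 : ℚ) 0 (-1) 2) = h.basis.j := by
      simp [lift, QuaternionAlgebra.Basis.lift, QuaternionAlgebra.basisOneIJK]
    have e3 : h.lift (QuaternionAlgebra.basisOneIJK (-3 : ℚ) 0 (-1) 3) = h.basis.k := by
      simp [lift, QuaternionAlgebra.Basis.lift, QuaternionAlgebra.basisOneIJK]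
    rw [e0, e1, e2, e3] at hx
    obtain ⟨h0, h1, h2, h3⟩ := h.eq_zero_of_combination_eq_zero hx
    rw [← hxs, h0, h1, h2, h3]
    simp
  have := (LinearMap.injective_iff_surjective_of_finrank_eq_finrank hfin
    (f := h.liftTensor.toLinearMap)).1 hinj
  exact ⟨hinj, this⟩

theorem nonempty_algEquiv (h : DicyclicPair R P) :
    Nonempty ((E ⊗[ℚ] ℍ[ℚ, -3, -1]) ≃ₐ[E] Matrix (Fin 2) (Fin 2) E) :=
  ⟨AlgEquiv.ofBijective _ h.bijective_liftTensor⟩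

end Field

end DicyclicPair

/-- Automorphisms of matrix algebras over fields are inner. -/
theorem Matrix.algEquiv_eq_conj {n E : Type*} [Fintype n] [DecidableEq n] [Field E]
    (f : Matrix n n E ≃ₐ[E] Matrix n n E) :
    ∃ g : GL n E, ∀ X, f X = g.1 * X * (g⁻¹).1 := by
  obtain ⟨T, hT⟩ := ((Matrix.toLinAlgEquiv'.symm.trans f).trans
    Matrix.toLinAlgEquiv').eq_linearEquivConjAlgEquiv
  refine ⟨⟨LinearMap.toMatrixAlgEquiv' T, LinearMap.toMatrixAlgEquiv' T.symm, ?_, ?_⟩, fun X => ?_⟩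
  · rw [← map_mul, ← map_one LinearMap.toMatrixAlgEquiv']; congr 1; ext; simp
  · rw [← map_mul, ← map_one LinearMap.toMatrixAlgEquiv']; congr 1; ext; simp
  · have := congr($hT (Matrix.toLinAlgEquiv' X))
    rw [LinearEquiv.conjAlgEquiv_apply] at this
    simp only [AlgEquiv.trans_apply, AlgEquiv.symm_apply_apply] at this
    apply Matrix.toLinAlgEquiv'.injective
    rw [this, map_mul, map_mul]
    simp only [Units.inv_mk]
    rw [Matrix.toLinAlgEquiv'_toMatrixAlgEquiv', Matrix.toLinAlgEquiv'_toMatrixAlgEquiv']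
    rfl

/-- Any two representations of the quaternion algebra given by pairs are conjugate. -/
theorem DicyclicPair.exists_conj {E : Type*} [Field E] [Algebra ℚ E]
    {R P : Matrix (Fin 2) (Fin 2) E} (h : DicyclicPair R P)
    (φ : (E ⊗[ℚ] ℍ[ℚ, -3, -1]) ≃ₐ[E] Matrix (Fin 2) (Fin 2) E) :
    ∃ g : GL (Fin 2) E, ∀ x, h.lift x = g.1 * φ (1 ⊗ₜ x) * (g⁻¹).1 := by
  obtain ⟨g, hg⟩ := Matrix.algEquiv_eq_conj
    (φ.symm.trans (AlgEquiv.ofBijective _ h.bijective_liftTensor))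
  refine ⟨g, fun x => ?_⟩
  rw [← hg, ← h.liftTensor_one_tmul]
  simp

/-! ### Integral forms as integral pairs -/

theorem dicyclicR_mem : dicyclicR ∈ dicyclicGroup :=
  Subgroup.subset_closure (by simp)

theorem dicyclicP_mem : dicyclicP ∈ dicyclicGroup :=
  Subgroup.subset_closure (by simp)

/-- The generator `r` as an element of the dicyclic group. -/
def dicyclicGroup.r : dicyclicGroup := ⟨dicyclicR, dicyclicR_mem⟩

/-- The generator `p` as an element of the dicyclic group. -/
def dicyclicGroup.p : dicyclicGroup := ⟨dicyclicP, dicyclicP_mem⟩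

theorem dicyclicGroup.hom_ext {M : Type*} [Group M] {f g : dicyclicGroup →* M}
    (hr : f r = g r) (hp : f p = g p) : f = g := by
  ext ⟨x, hx⟩
  induction hx using Subgroup.closure_induction with
  | mem x hx =>
    rcases hx with rfl | hx
    · exact hr
    · obtain rfl := hx
      exact hp
  | one => exact (map_one f).trans (map_one g).symm
  | mul x y hx hy h1 h2 =>
    exact (map_mul f ⟨x, hx⟩ ⟨y, hy⟩).trans
      ((congrArg₂ _ h1 h2).trans (map_mul g ⟨x, hx⟩ ⟨y, hy⟩).symm)
  | inv x hx h1 => exact (map_inv f ⟨x, hx⟩).trans ((congrArg _ h1).trans (map_inv g ⟨x, hx⟩).symm)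

section Rep

variable {E : Type*} [Field E] [Algebra ℚ E] {O : Subring E}
  {φ : (E ⊗[ℚ] ℍ[ℚ, -3, -1]) ≃ₐ[E] Matrix (Fin 2) (Fin 2) E}

theorem dicyclicRep_apply (x : dicyclicGroup) :
    (dicyclicRep φ x).1 = φ (1 ⊗ₜ x.1.1) := rfl

variable (φ) in
theorem dicyclicPair_dicyclicRep :
    DicyclicPair (dicyclicRep φ dicyclicGroup.r).1 (dicyclicRep φ dicyclicGroup.p).1 := by
  simp only [dicyclicRep_apply, dicyclicGroup.r, dicyclicGroup.p]
  have e : ∀ x y : ℍ[ℚ, -3, -1], φ (1 ⊗ₜ x) * φ (1 ⊗ₜ y) = φ (1 ⊗ₜ (x * y)) := by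
    intro x y; rw [← map_mul, Algebra.TensorProduct.tmul_mul_tmul, one_mul]
  have e1 : (1 : Matrix (Fin 2) (Fin 2) E) = φ (1 ⊗ₜ (1 : ℍ[ℚ, -3, -1])) := (map_one φ).symm
  refine ⟨?_, ?_, ?_⟩
  · rw [e, e1, ← map_sub, ← TensorProduct.tmul_sub]
    congr 2
    ext <;> norm_num [dicyclicR]
  · rw [e, e1, ← map_neg, ← TensorProduct.tmul_neg]
    congr 2
    ext <;> norm_num [dicyclicP]
  · rw [e1, ← map_sub, ← TensorProduct.tmul_sub, e, e]
    congr 2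
    ext <;> norm_num [dicyclicP, dicyclicR]

theorem IntegralRep.dicyclicPair (σ : IntegralRep O (dicyclicRep φ)) :
    DicyclicPair (σ.1 dicyclicGroup.r).1 (σ.1 dicyclicGroup.p).1 := by
  obtain ⟨g, hg⟩ := σ.2
  refine DicyclicPair.of_map (f := O.subtype) Subtype.val_injective ?_
  have h := (dicyclicPair_dicyclicRep φ).conj g
  have e : ∀ x, O.subtype.mapMatrix (σ.1 x).1 = g.1 * (dicyclicRep φ x).1 * (g⁻¹).1 :=
    fun x => congrArg Units.val (hg x)
  rw [e, e]
  exact h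

-- The pair defines a representation of the group over `E`. Its values lie in `GL₂(O)` because those
-- of the two generators do, and it is conjugate to `ρ` by Skolem–Noether.
variable (φ) in
theorem DicyclicPair.exists_integralRep {R P : Matrix (Fin 2) (Fin 2) O} (h : DicyclicPair R P) :
    ∃ σ : IntegralRep O (dicyclicRep φ),
      (σ.1 dicyclicGroup.r).1 = R ∧ (σ.1 dicyclicGroup.p).1 = P := by
  have hE := h.map O.subtype
  have hinj : Function.Injective (Matrix.GeneralLinearGroup.map (n := Fin 2) O.subtype) :=
    Units.map_injective (Matrix.map_injective Subtype.val_injective)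
  let f : dicyclicGroup →* GL (Fin 2) E :=
    (Units.map (hE.lift : ℍ[ℚ, -3, -1] →* Matrix (Fin 2) (Fin 2) E)).comp dicyclicGroup.subtype
  have hr : Matrix.GeneralLinearGroup.map O.subtype h.isUnit_r.unit = f dicyclicGroup.r :=
    Units.ext hE.lift_r.symm
  have hp : Matrix.GeneralLinearGroup.map O.subtype h.isUnit_p.unit = f dicyclicGroup.p :=
    Units.ext hE.lift_p.symm
  have hf : ∀ x, f x ∈ (Matrix.GeneralLinearGroup.map (n := Fin 2) O.subtype).range := by
    have : dicyclicGroup ≤ (Matrix.GeneralLinearGroup.map (n := Fin 2) O.subtype).range.comap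
        (Units.map (hE.lift : ℍ[ℚ, -3, -1] →* Matrix (Fin 2) (Fin 2) E)) := by
      refine (Subgroup.closure_le _).2 ?_
      rintro x (rfl | rfl)
      · exact ⟨_, hr⟩
      · exact ⟨_, hp⟩
    exact fun x => this x.2
  let σ : dicyclicGroup →* GL (Fin 2) O :=
    (MonoidHom.ofInjective hinj).symm.toMonoidHom.comp (f.codRestrict _ hf)
  have hσ : ∀ x, Matrix.GeneralLinearGroup.map O.subtype (σ x) = f x := by
    intro x
    have := congrArg Subtype.val
      ((MonoidHom.ofInjective hinj).apply_symm_apply (f.codRestrict _ hf x))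
    exact this
  obtain ⟨g, hg⟩ := hE.exists_conj φ
  refine ⟨⟨σ, g, fun x => ?_⟩, ?_, ?_⟩
  · rw [hσ]
    exact Units.ext (hg _)
  · exact congrArg Units.val (hinj ((hσ dicyclicGroup.r).trans hr.symm))
  · exact congrArg Units.val (hinj ((hσ dicyclicGroup.p).trans hp.symm))

theorem integralRepSetoid_of_intertwining {σ τ : IntegralRep O (dicyclicRep φ)}
    {H : Matrix (Fin 2) (Fin 2) O} (hH : IsUnit H.det)
    (hr : H * (σ.1 dicyclicGroup.r).1 = (τ.1 dicyclicGroup.r).1 * H)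
    (hp : H * (σ.1 dicyclicGroup.p).1 = (τ.1 dicyclicGroup.p).1 * H) :
    integralRepSetoid O (dicyclicRep φ) σ τ := by
  obtain ⟨h, rfl⟩ := (Matrix.isUnit_iff_isUnit_det H).2 hH
  refine ⟨h, fun x => ?_⟩
  have : τ.1 = (MulAut.conj h).toMonoidHom.comp σ.1 := by
    refine dicyclicGroup.hom_ext ?_ ?_
    · exact eq_mul_inv_of_mul_eq (Units.ext hr.symm)
    · exact eq_mul_inv_of_mul_eq (Units.ext hp.symm)
  exact congr($this x)

theorem exists_intertwining_of_integralRepSetoid {σ τ : IntegralRep O (dicyclicRep φ)}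
    (h : integralRepSetoid O (dicyclicRep φ) σ τ) :
    ∃ H : Matrix (Fin 2) (Fin 2) O, IsUnit H.det ∧
      H * (σ.1 dicyclicGroup.r).1 = (τ.1 dicyclicGroup.r).1 * H ∧
      H * (σ.1 dicyclicGroup.p).1 = (τ.1 dicyclicGroup.p).1 * H := by
  obtain ⟨h, hh⟩ := h
  refine ⟨h.1, (Matrix.isUnit_iff_isUnit_det _).1 h.isUnit, ?_, ?_⟩
  · exact congrArg Units.val (eq_mul_inv_iff_mul_eq.1 (hh dicyclicGroup.r)).symm
  · exact congrArg Units.val (eq_mul_inv_iff_mul_eq.1 (hh dicyclicGroup.p)).symm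

/-- Two integral forms are conjugate by a matrix over the field. -/
theorem IntegralRep.exists_conj (σ τ : IntegralRep O (dicyclicRep φ)) :
    ∃ g : GL (Fin 2) E, ∀ x, g.1 * O.subtype.mapMatrix (σ.1 x).1 =
      O.subtype.mapMatrix (τ.1 x).1 * g.1 := by
  obtain ⟨g, hg⟩ := σ.2
  obtain ⟨k, hk⟩ := τ.2
  refine ⟨k * g⁻¹, fun x => ?_⟩
  have : k * g⁻¹ * Matrix.GeneralLinearGroup.map O.subtype (σ.1 x) =
      Matrix.GeneralLinearGroup.map O.subtype (τ.1 x) * (k * g⁻¹) := by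
    rw [hg, hk]; group
  exact congrArg Units.val this

end Rep

/-! ### Primitive intertwiners and uniqueness -/

/-- A nonzero matrix over the fraction field of a valuation ring has a primitive multiple. -/
theorem Matrix.exists_smul_eq_map_of_mem_or_inv_mem {n E : Type*} [Finite n] [Field E]
    {O : Subring E} (hO : ∀ x : E, x ∈ O ∨ x⁻¹ ∈ O) {M : Matrix n n E} (hM : M ≠ 0) :
    ∃ (c : E) (N : Matrix n n O), c ≠ 0 ∧ c • M = N.map O.subtype ∧ ∃ i j, N i j = 1 := by
  let V := ValuationSubring.ofSubring O hO
  obtain ⟨i₀, j₀, h₀⟩ : ∃ i j, M i j ≠ 0 := by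
    by_contra! h
    exact hM (Matrix.ext h)
  have : Nonempty (n × n) := ⟨(i₀, j₀)⟩
  -- Dividing by an entry of largest valuation makes all entries integral and that entry `1`.
  obtain ⟨⟨i, j⟩, hij⟩ := Finite.exists_max fun x : n × n => V.valuation (M x.1 x.2)
  have hne : M i j ≠ 0 := by
    intro h
    have := hij (i₀, j₀)
    simp only [h, map_zero, le_zero_iff, map_eq_zero] at this
    exact h₀ this
  have hmem : ∀ a b, (M i j)⁻¹ * M a b ∈ O := by
    intro a b
    refine V.mem_of_valuation_le_one _ ?_
    rw [map_mul, map_inv₀, inv_mul_le_iff₀ (by simpa [zero_lt_iff] using hne), mul_one]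
    exact hij (a, b)
  refine ⟨(M i j)⁻¹, fun a b => ⟨_, hmem a b⟩, inv_ne_zero hne, rfl, i, j, ?_⟩
  exact Subtype.ext (inv_mul_cancel₀ hne)

/-- Two matrices with a nonzero singular intertwiner into another pair share an eigenvector. -/
theorem Matrix.exists_common_eigenvector {k : Type*} [Field k]
    {N R P R' P' : Matrix (Fin 2) (Fin 2) k} (hN : N ≠ 0) (hdet : N.det = 0)
    (hR : N * R = R' * N) (hP : N * P = P' * N) :
    ∃ v ≠ 0, (∃ a : k, R.mulVec v = a • v) ∧ ∃ b : k, P.mulVec v = b • v := by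
  obtain ⟨v, hv, hNv⟩ := Matrix.exists_mulVec_eq_zero_iff.2 hdet
  -- The kernel of `N` is a line, since `N ≠ 0`; the intertwining relations make it stable under `R`
  -- and `P`.
  have key : ∀ w, N.mulVec w = 0 → ∃ a : k, w = a • v := by
    intro w hw
    by_contra! h
    have hli : LinearIndependent k ![v, w] :=
      (LinearIndependent.pair_iff' hv).2 fun a ha => h a ha.symm
    refine hN ?_
    have hspan := hli.span_eq_top_of_card_eq_finrank (by simp)
    have : Matrix.toLin' N = 0 := by
      refine LinearMap.ext_on_range hspan ?_
      intro i
      fin_cases i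
      · simpa using hNv
      · simpa using hw
    simpa using this
  refine ⟨v, hv, key _ ?_, key _ ?_⟩
  · rw [mulVec_mulVec, hR, ← mulVec_mulVec, hNv, mulVec_zero]
  · rw [mulVec_mulVec, hP, ← mulVec_mulVec, hNv, mulVec_zero]

/-- On a common eigenline the relations become scalar: `a b = (1 - a) b` with `b ≠ 0` gives `2 a =
1`, and then `0 = 4 (a ^ 2 - a + 1) = (2 a - 1) ^ 2 + 3 = 3`. -/
theorem DicyclicPair.eigenvalue_relations {k : Type*} [Field k]
    {R P : Matrix (Fin 2) (Fin 2) k} (h : DicyclicPair R P) {v : Fin 2 → k} (hv : v ≠ 0) {a b : k}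
    (ha : R.mulVec v = a • v) (hb : P.mulVec v = b • v) : b ^ 2 = -1 ∧ (3 : k) = 0 := by
  have h1 : (a * a - a + 1) • v = 0 := by
    have := congr(Matrix.mulVec $h.r_sq v)
    rw [← Matrix.mulVec_mulVec, ha, Matrix.mulVec_smul, ha, Matrix.sub_mulVec, ha,
      Matrix.one_mulVec, ← sub_eq_zero] at this
    rw [← this]; module
  have h2 : (b ^ 2 + 1) • v = 0 := by
    have := congr(Matrix.mulVec $h.p_sq v)
    rw [← Matrix.mulVec_mulVec, hb, Matrix.mulVec_smul, hb, Matrix.neg_mulVec,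
      Matrix.one_mulVec, ← sub_eq_zero] at this
    rw [← this]; module
  have h3 : (a * b - (1 - a) * b) • v = 0 := by
    have := congr(Matrix.mulVec $h.p_mul_r v)
    rw [← Matrix.mulVec_mulVec, ha, Matrix.mulVec_smul, hb, ← Matrix.mulVec_mulVec, hb,
      Matrix.mulVec_smul, Matrix.sub_mulVec, ha, Matrix.one_mulVec, ← sub_eq_zero] at this
    rw [← this]; module
  replace h1 := (smul_eq_zero.1 h1).resolve_right hv
  replace h2 := (smul_eq_zero.1 h2).resolve_right hv
  replace h3 := (smul_eq_zero.1 h3).resolve_right hv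
  refine ⟨by linear_combination h2, ?_⟩
  have hb0 : b ≠ 0 := by
    rintro rfl
    simp at h2
  have h4 : 2 * a - 1 = 0 := by
    refine (mul_eq_zero.1 (?_ : b * (2 * a - 1) = 0)).resolve_left hb0
    linear_combination h3
  linear_combination 4 * h1 - (2 * a - 1) * h4

section Uniqueness

variable {E : Type*} [Field E] [Algebra ℚ E] {O : Subring E} [IsLocalRing O]
  {φ : (E ⊗[ℚ] ℍ[ℚ, -3, -1]) ≃ₐ[E] Matrix (Fin 2) (Fin 2) E}

/-- Integral forms over a valuation ring are unique unless the residue field has characteristic `3`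
and contains a square root of `-1`. -/
theorem integralRepSetoid_of_residueField (hO : ∀ x : E, x ∈ O ∨ x⁻¹ ∈ O)
    (hk : (3 : IsLocalRing.ResidueField O) = 0 → ∀ b : IsLocalRing.ResidueField O, b ^ 2 ≠ -1)
    (σ τ : IntegralRep O (dicyclicRep φ)) :
    integralRepSetoid O (dicyclicRep φ) σ τ := by
  obtain ⟨g, hg⟩ := σ.exists_conj τ
  obtain ⟨c, N, hc, hN, i, j, hij⟩ := Matrix.exists_smul_eq_map_of_mem_or_inv_mem hO
    (M := g.1) g.ne_zero
  have hinj : Function.Injective (O.subtype.mapMatrix (m := Fin 2)) :=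
    Matrix.map_injective Subtype.val_injective
  have hint : ∀ x, N * (σ.1 x).1 = (τ.1 x).1 * N := by
    intro x
    apply hinj
    have hN' : O.subtype.mapMatrix N = c • g.1 := hN.symm
    rw [map_mul, map_mul, hN', Matrix.smul_mul, Matrix.mul_smul, hg]
  refine integralRepSetoid_of_intertwining (H := N) ?_ (hint _) (hint _)
  by_contra hdet
  let π := IsLocalRing.residue O
  have hdet' : (π.mapMatrix N).det = 0 := by
    rw [← RingHom.map_det]
    exact (IsLocalRing.residue_eq_zero_iff _).2 hdet
  have hint' : ∀ x, π.mapMatrix N * π.mapMatrix (σ.1 x).1 = π.mapMatrix (τ.1 x).1 * π.mapMatrix N := by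
    intro x
    rw [← map_mul, hint, map_mul]
  -- Primitivity is used here: the entry `1` survives reduction.
  have hN0 : π.mapMatrix N ≠ 0 := by
    intro h
    have := congr($h i j)
    simp [hij] at this
  obtain ⟨v, hv, ⟨a, ha⟩, b, hb⟩ := Matrix.exists_common_eigenvector hN0 hdet'
    (hint' dicyclicGroup.r) (hint' dicyclicGroup.p)
  obtain ⟨h1, h3⟩ := DicyclicPair.eigenvalue_relations (σ.dicyclicPair.map π) hv ha hb
  exact hk h3 b h1

theorem card_integralForms_eq_one (hO : ∀ x : E, x ∈ O ∨ x⁻¹ ∈ O)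
    (hk : (3 : IsLocalRing.ResidueField O) = 0 → ∀ b : IsLocalRing.ResidueField O, b ^ 2 ≠ -1)
    {R P : Matrix (Fin 2) (Fin 2) O} (h : DicyclicPair R P) :
    ENat.card (IntegralForms O (dicyclicRep φ)) = 1 := by
  obtain ⟨σ, -⟩ := h.exists_integralRep φ
  have : Nonempty (IntegralForms O (dicyclicRep φ)) := ⟨Quotient.mk _ σ⟩
  have : Subsingleton (IntegralForms O (dicyclicRep φ)) := by
    refine ⟨fun x y => ?_⟩
    induction x using Quotient.inductionOn
    induction y using Quotient.inductionOn
    exact Quotient.sound (integralRepSetoid_of_residueField hO hk _ _)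
  exact ENat.card_eq_one_iff_unique.2
    ((unique_iff_subsingleton_and_nonempty _).2 ⟨‹_›, ‹_›⟩)

end Uniqueness

/-! ### The ring of integers through the spectral norm -/

section LocalIntegers

variable {p : ℕ} [Fact p.Prime] {E : Type*} [Field E] [Algebra ℚ_[p] E]

/-- Since `ℤ_p` is integrally closed, `x` is integral exactly when its minimal polynomial over `ℚ_p`
has coefficients in `ℤ_p`, and this is what spectral norm at most `1` means. -/
theorem mem_localIntegers_iff [Algebra.IsAlgebraic ℚ_[p] E] {x : E} :
    x ∈ localIntegers p E ↔ spectralNorm ℚ_[p] E x ≤ 1 := by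
  let : Algebra ℤ_[p] E := ((algebraMap ℚ_[p] E).comp (algebraMap ℤ_[p] ℚ_[p])).toAlgebra
  have : IsScalarTower ℤ_[p] ℚ_[p] E := .of_algebraMap_eq fun _ => rfl
  have hx : IsIntegral ℚ_[p] x := Algebra.IsIntegral.isIntegral x
  change IsIntegral ℤ_[p] x ↔ _
  rw [spectralNorm, spectralValue_le_one_iff (minpoly.monic hx)]
  constructor
  · intro h n
    rw [minpoly.isIntegrallyClosed_eq_field_fractions' ℚ_[p] h, Polynomial.coeff_map]
    exact PadicInt.norm_le_one _
  · intro h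
    have hlift : minpoly ℚ_[p] x ∈ Polynomial.lifts (algebraMap ℤ_[p] ℚ_[p]) :=
      (Polynomial.lifts_iff_coeff_lifts _).2 fun n => ⟨⟨_, h n⟩, rfl⟩
    obtain ⟨q, hq, -, hmon⟩ :=
      Polynomial.lifts_and_natDegree_eq_and_monic hlift (minpoly.monic hx)
    refine ⟨q, hmon, ?_⟩
    have := minpoly.aeval ℚ_[p] x
    rw [← hq, Polynomial.aeval_map_algebraMap] at this
    exact this

variable [Algebra.IsAlgebraic ℚ_[p] E]

theorem padic_spectralNorm_mul (x y : E) :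
    spectralNorm ℚ_[p] E (x * y) = spectralNorm ℚ_[p] E x * spectralNorm ℚ_[p] E y :=
  map_mul (spectralMulAlgNorm ℚ_[p] E) x y

theorem padic_spectralNorm_inv (x : E) :
    spectralNorm ℚ_[p] E x⁻¹ = (spectralNorm ℚ_[p] E x)⁻¹ :=
  let := spectralNorm.normedField ℚ_[p] E
  norm_inv x

theorem padic_spectralNorm_ne_zero {x : E} (hx : x ≠ 0) : spectralNorm ℚ_[p] E x ≠ 0 :=
  let := spectralNorm.normedField ℚ_[p] E
  norm_ne_zero_iff.2 hx

variable (p) in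
theorem mem_or_inv_mem_localIntegers (x : E) :
    x ∈ localIntegers p E ∨ x⁻¹ ∈ localIntegers p E := by
  rw [mem_localIntegers_iff, mem_localIntegers_iff, padic_spectralNorm_inv]
  rcases le_total (spectralNorm ℚ_[p] E x) 1 with h | h
  · exact .inl h
  · exact .inr (inv_le_one_of_one_le₀ h)

instance valuationRing_localIntegers : ValuationRing (localIntegers p E) :=
  inferInstanceAs (ValuationRing
    (ValuationSubring.ofSubring (localIntegers p E) (mem_or_inv_mem_localIntegers p)))

theorem isUnit_localIntegers_iff {x : localIntegers p E} :
    IsUnit x ↔ spectralNorm ℚ_[p] E x = 1 := by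
  constructor
  · rintro ⟨u, rfl⟩
    have h : spectralNorm ℚ_[p] E u.1 * spectralNorm ℚ_[p] E u⁻¹.1 = 1 := by
      rw [← padic_spectralNorm_mul, ← Subring.coe_mul, Units.mul_inv]
      exact spectralNorm_one
    refine le_antisymm (mem_localIntegers_iff.1 u.1.2) ?_
    rw [← h]
    exact mul_le_of_le_one_right (spectralNorm_nonneg _) (mem_localIntegers_iff.1 u⁻¹.1.2)
  · intro h
    have h0 : (x : E) ≠ 0 := by
      intro h0
      rw [h0, spectralNorm_zero] at h
      exact zero_ne_one h
    refine .of_mul_eq_one ⟨(x : E)⁻¹, mem_localIntegers_iff.2 ?_⟩ (Subtype.ext (mul_inv_cancel₀ h0))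
    rw [padic_spectralNorm_inv, h, inv_one]

theorem exists_unit_localIntegers_eq {x : E} (hx : spectralNorm ℚ_[p] E x = 1) :
    ∃ u : (localIntegers p E)ˣ, ((u : localIntegers p E) : E) = x := by
  obtain ⟨z, rfl⟩ : ∃ z : localIntegers p E, (z : E) = x :=
    ⟨⟨x, mem_localIntegers_iff.2 hx.le⟩, rfl⟩
  exact ⟨(isUnit_localIntegers_iff.2 hx).unit, rfl⟩

variable (p E) in
/-- The structure map from the `p`-adic integers to the ring of integers. -/
noncomputable def padicIntToLocalIntegers : ℤ_[p] →+* localIntegers p E :=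
  ((algebraMap ℚ_[p] E).comp PadicInt.Coe.ringHom).codRestrict _ fun x =>
    mem_localIntegers_iff.2 ((spectralNorm_extends _).trans_le (PadicInt.norm_le_one x))

theorem isUnit_natCast_localIntegers {n : ℕ} (hn : p.Coprime n) :
    IsUnit (n : localIntegers p E) := by
  rw [isUnit_localIntegers_iff, ← Padic.norm_natCast_eq_one_iff.2 hn,
    ← spectralNorm_extends (L := E)]
  simp

theorem residue_eq_zero_iff_spectralNorm_lt_one {x : localIntegers p E} :
    IsLocalRing.residue _ x = 0 ↔ spectralNorm ℚ_[p] E x < 1 := by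
  rw [IsLocalRing.residue_eq_zero_iff, IsLocalRing.mem_maximalIdeal, mem_nonunits_iff,
    isUnit_localIntegers_iff]
  exact ⟨fun h => lt_of_le_of_ne (mem_localIntegers_iff.1 x.2) h, fun h => h.ne⟩

/-- For odd `p`, a square root of `-1` in the residue field lifts. -/
theorem exists_sq_eq_neg_one_of_residueField (hp : p ≠ 2)
    {b : IsLocalRing.ResidueField (localIntegers p E)} (hb : b ^ 2 = -1) :
    ∃ s : E, s ^ 2 = -1 := by
  obtain ⟨x, rfl⟩ := IsLocalRing.residue_surjective b
  have hx : spectralNorm ℚ_[p] E ((x : E) ^ 2 + 1) < 1 := by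
    have h : IsLocalRing.residue _ (x ^ 2 + 1) = 0 := by
      rw [map_add, map_pow, hb, map_one, neg_add_cancel]
    rw [residue_eq_zero_iff_spectralNorm_lt_one] at h
    rwa [Subring.coe_add, Subring.coe_pow, Subring.coe_one] at h
  let C := AlgebraicClosure E
  have : Algebra.IsAlgebraic ℚ_[p] C := Algebra.IsAlgebraic.trans ℚ_[p] E C
  let : NontriviallyNormedField C := spectralNorm.nontriviallyNormedField ℚ_[p] C
  let : NormedAlgebra ℚ_[p] C := spectralNorm.normedAlgebra ℚ_[p] C
  have : IsUltrametricDist C := IsUltrametricDist.of_normedAlgebra ℚ_[p]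
  let y : C := algebraMap E C x
  have hy : ‖y ^ 2 + 1‖ < 1 := by
    have : spectralNorm ℚ_[p] C (algebraMap E C ((x : E) ^ 2 + 1)) < 1 :=
      (spectralNorm.eq_of_tower ((x : E) ^ 2 + 1)).symm.trans_lt hx
    rw [map_add, map_pow, map_one] at this
    exact this
  have h2 : ‖(2 : C)‖ = 1 := by
    have : ‖(2 : ℚ_[p])‖ = 1 := by
      refine Padic.norm_natCast_eq_one_iff.2 ?_
      exact (Nat.coprime_primes Fact.out Nat.prime_two).2 hp
    rw [← this, ← norm_algebraMap' C (2 : ℚ_[p]), map_ofNat]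
  obtain ⟨i, hi⟩ := IsAlgClosed.exists_pow_nat_eq (-1 : C) two_pos
  -- As `(i - y) (-i - y) = y ^ 2 + 1` has norm less than `1`, one of the roots `±i` is at distance
  -- less than `1` from `y`.
  obtain ⟨j, hj, hjy⟩ : ∃ j : C, j ^ 2 = -1 ∧ ‖j - y‖ < 1 := by
    by_contra! h
    have h1 := h i hi
    have h2 := h (-i) (by rw [neg_sq, hi])
    have : (i - y) * (-i - y) = y ^ 2 + 1 := by linear_combination -hi
    rw [← this, norm_mul] at hy
    exact absurd hy (not_lt.2 (one_le_mul_of_one_le_of_one_le h1 h2))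
  have hj1 : ‖j‖ = 1 := by
    have := congrArg norm hj
    rw [norm_pow, norm_neg, norm_one] at this
    exact (pow_eq_one_iff_of_nonneg (norm_nonneg _) two_ne_zero).1 this
  have hjint : IsIntegral ℚ_[p] j := Algebra.IsIntegral.isIntegral j
  -- Krasner's lemma applies: the only other possible conjugate `-j` is at distance `‖2 j‖ = 1` from
  -- `j`, farther than `y`.
  have hmem : j ∈ IntermediateField.adjoin ℚ_[p] {y} := by
    refine IsKrasner.krasner (minpoly.irreducible hjint).separable (IsAlgClosed.splits _)
      (Algebra.IsIntegral.isIntegral y) fun j' hj' hne => ?_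
    have hj'2 : j' ^ 2 = -1 := by
      have hdvd : minpoly ℚ_[p] j ∣ Polynomial.X ^ 2 + 1 := minpoly.dvd _ _ (by simp [hj])
      have := Polynomial.aeval_eq_zero_of_dvd_aeval_eq_zero hdvd hj'.aeval_eq_zero
      simp only [map_add, map_pow, Polynomial.aeval_X, map_one] at this
      exact eq_neg_of_add_eq_zero_left this
    have : j' = -j := by
      rcases sq_eq_sq_iff_eq_or_eq_neg.1 (hj'2.trans hj.symm) with h | h
      · exact absurd h.symm hne
      · exact h
    rw [this, sub_neg_eq_add, ← two_mul, norm_mul, h2, hj1, one_mul]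
    exact hjy
  have hle : IntermediateField.adjoin ℚ_[p] {y} ≤ (IsScalarTower.toAlgHom ℚ_[p] E C).fieldRange := by
    rw [IntermediateField.adjoin_simple_le_iff]
    exact ⟨x, rfl⟩
  obtain ⟨s, hs⟩ := hle hmem
  refine ⟨s, (algebraMap E C).injective ?_⟩
  have hs' : algebraMap E C s = j := hs
  rw [map_pow, hs', hj, map_neg, map_one]

end LocalIntegers

/-! ### Quadratic extensions, the norm form and squares in `ℚ_3` -/

/-- A quadratic extension away from characteristic `2` contains the square root of a nonsquare. -/
theorem exists_sq_eq_algebraMap_of_finrank_eq_two {K F : Type*} [Field K] [Field F] [Algebra K F]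
    (h2 : (2 : K) ≠ 0) (hF : Module.finrank K F = 2) :
    ∃ (y : F) (d : K), y ^ 2 = algebraMap K F d ∧ y ∉ Set.range (algebraMap K F) := by
  obtain ⟨z, hz⟩ : ∃ z : F, ∀ c : K, c • (1 : F) ≠ z := by
    by_contra! h
    have := finrank_le_one (1 : F) h
    omega
  have hspan := ((LinearIndependent.pair_iff' (one_ne_zero (α := F))).2
    hz).span_eq_top_of_card_eq_finrank (by simpa using hF.symm)
  have hmem : z ^ 2 ∈ Submodule.span K (Set.range ![1, z]) := hspan ▸ Submodule.mem_top
  rw [Matrix.range_cons, Matrix.range_cons, Matrix.range_empty, Set.union_empty,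
    Set.singleton_union, Submodule.mem_span_pair] at hmem
  obtain ⟨a, b, hab⟩ := hmem
  rw [Algebra.smul_def, Algebra.smul_def, mul_one] at hab
  have h2' : algebraMap K F 2 ≠ 0 := by simpa using h2
  refine ⟨z - algebraMap K F (b / 2), a + (b / 2) ^ 2, ?_, ?_⟩
  · have hb : algebraMap K F b = 2 * algebraMap K F (b / 2) := by
      rw [← map_ofNat (algebraMap K F) 2, ← map_mul, mul_div_cancel₀ _ h2]
    rw [map_add, map_pow]
    rw [hb] at hab
    linear_combination -hab
  · rintro ⟨c, hc⟩
    refine hz (c + b / 2) ?_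
    rw [Algebra.smul_def, mul_one, map_add, hc, sub_add_cancel]

/-- `-1` is represented by the norm form of `ℤ[r]` over the `p`-adic integers. -/
theorem PadicInt.exists_sq_sub_mul_add_sq_eq_neg_one {p : ℕ} [Fact p.Prime] (hp : p ≠ 3) :
    ∃ a b : ℤ_[p], a ^ 2 - a * b + b ^ 2 = -1 := by
  have hex : ∃ a b : ZMod p, a ^ 2 - a * b + b ^ 2 = -1 := by
    rcases eq_or_ne p 2 with rfl | hp2
    · exact ⟨1, 0, by simp⟩
    have h2 : (2 : ZMod p) ≠ 0 := by
      intro h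
      have := (ZMod.natCast_eq_zero_iff 2 p).1 h
      exact hp2 ((Nat.prime_dvd_prime_iff_eq Fact.out Nat.prime_two).1 this)
    have h3 : (3 : ZMod p) ≠ 0 := by
      intro h
      have := (ZMod.natCast_eq_zero_iff 3 p).1 h
      exact hp ((Nat.prime_dvd_prime_iff_eq Fact.out Nat.prime_three).1 this)
    -- For `a = (x + y) / 2` and `b = y` the form equals `(x ^ 2 + 3 y ^ 2) / 4`, so a zero of `x ^
    -- 2 + 3 y ^ 2 + 4` is sought.
    obtain ⟨x, y, hxy⟩ := FiniteField.exists_root_sum_quadratic (R := ZMod p)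
      (f := Polynomial.X ^ 2) (g := Polynomial.C 3 * Polynomial.X ^ 2 + Polynomial.C 0 * Polynomial.X
        + Polynomial.C 4) (Polynomial.degree_X_pow 2) (Polynomial.degree_quadratic h3)
      (by rw [ZMod.card]; exact Nat.odd_iff.1 ((Fact.out : p.Prime).odd_of_ne_two hp2))
    simp only [Polynomial.eval_pow, Polynomial.eval_X, Polynomial.eval_add, Polynomial.eval_mul,
      Polynomial.eval_C] at hxy
    refine ⟨(x + y) / 2, y, ?_⟩
    field_simp
    linear_combination hxy
  have hunit : ∀ z : ℤ_[p], PadicInt.toZMod z ≠ 0 → ‖z‖ = 1 := by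
    intro z hz
    refine PadicInt.isUnit_iff.1 ?_
    by_contra h
    refine hz ?_
    rw [← RingHom.mem_ker, PadicInt.ker_toZMod]
    exact h
  have hlift : ∀ a b : ZMod p, a ^ 2 - a * b + b ^ 2 = -1 → 2 * a - b ≠ 0 →
      ∃ x y : ℤ_[p], x ^ 2 - x * y + y ^ 2 = -1 := by
    intro a b hab hne
    obtain ⟨x, rfl⟩ := ZMod.ringHom_surjective PadicInt.toZMod a
    obtain ⟨y, rfl⟩ := ZMod.ringHom_surjective PadicInt.toZMod b
    obtain ⟨c, hc⟩ : ∃ c, c = y ^ 2 + 1 := ⟨_, rfl⟩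
    let F : Polynomial ℤ_[p] := Polynomial.X ^ 2 - Polynomial.C y * Polynomial.X + Polynomial.C c
    have hF : ∀ w, Polynomial.aeval w F = w ^ 2 - y * w + c := by
      intro w; simp [F]
    have hF' : ∀ w, Polynomial.aeval w (Polynomial.derivative F) = 2 * w - y := by
      intro w; simp [F, one_add_one_eq_two]
    have h1 : ‖Polynomial.aeval x (Polynomial.derivative F)‖ = 1 := by
      rw [hF']
      refine hunit _ ?_
      rwa [map_sub, map_mul, map_ofNat]
    have h2 : ‖Polynomial.aeval x F‖ < 1 := by
      rw [hF, hc, ← PadicInt.mem_nonunits, ← IsLocalRing.mem_maximalIdeal, ← PadicInt.ker_toZMod,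
        RingHom.mem_ker]
      simp only [map_add, map_sub, map_mul, map_pow, map_one]
      linear_combination hab
    obtain ⟨z, hz, -⟩ := hensels_lemma (F := F) (a := x) (by rwa [h1, one_pow])
    refine ⟨z, y, ?_⟩
    rw [hF, hc] at hz
    linear_combination hz
  obtain ⟨a, b, hab⟩ := hex
  -- Hensel's lemma in the first variable needs `2 a - b ≠ 0`. Otherwise the variables are
  -- exchanged: if `2 b - a` vanished too, then `3 a = 0` and the form would be `3 a ^ 2 = 0`.
  by_cases h : 2 * a - b = 0
  · refine hlift b a (by linear_combination hab) fun h' => ?_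
    have hb : b = 2 * a := (sub_eq_zero.1 h).symm
    subst hb
    have h3a : 3 * a = 0 := by linear_combination h'
    exact one_ne_zero (α := ZMod p) (by linear_combination hab - a * h3a)
  · exact hlift a b hab h

/-- Hensel's lemma for `X ^ 2 - u` at `1`, where the derivative `2` is a unit. -/
theorem PadicInt.exists_sq_eq_of_norm_sub_one_lt {p : ℕ} [Fact p.Prime] (hp : p ≠ 2) {u : ℤ_[p]}
    (hu : ‖u - 1‖ < 1) : ∃ w : ℤ_[p], w ^ 2 = u := by
  let F : Polynomial ℤ_[p] := Polynomial.X ^ 2 - Polynomial.C u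
  have h1 : ‖Polynomial.aeval (1 : ℤ_[p]) (Polynomial.derivative F)‖ = 1 := by
    have : Polynomial.aeval (1 : ℤ_[p]) (Polynomial.derivative F) = ((2 : ℕ) : ℤ_[p]) := by
      simp [F, one_add_one_eq_two]
    rw [this]
    exact PadicInt.norm_natCast_eq_one_iff.2 ((Nat.coprime_primes Fact.out Nat.prime_two).2 hp)
  have h2 : Polynomial.aeval (1 : ℤ_[p]) F = 1 - u := by simp [F]
  obtain ⟨z, hz, -⟩ := hensels_lemma (F := F) (a := 1) (by rwa [h1, one_pow, h2, norm_sub_rev])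
  refine ⟨z, ?_⟩
  have : Polynomial.aeval z F = z ^ 2 - u := by simp [F]
  exact sub_eq_zero.1 (this.symm.trans hz)

theorem PadicInt.exists_sq_eq_neg_two : ∃ w : ℤ_[3], w ^ 2 = -2 := by
  refine PadicInt.exists_sq_eq_of_norm_sub_one_lt (by decide) ?_
  rw [PadicInt.norm_lt_one_iff_dvd]
  exact ⟨-1, by norm_num⟩

/-- One of `u` and `-u` is congruent to `1` modulo `3`. -/
theorem PadicInt.exists_sq_eq_or_neg_of_isUnit {u : ℤ_[3]} (hu : IsUnit u) :
    ∃ w : ℤ_[3], w ^ 2 = u ∨ w ^ 2 = -u := by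
  have hne : PadicInt.toZMod u ≠ 0 := (hu.map _).ne_zero
  have hlt : ∀ z : ℤ_[3], PadicInt.toZMod z = 1 → ‖z - 1‖ < 1 := by
    intro z hz
    rw [← PadicInt.mem_nonunits, ← IsLocalRing.mem_maximalIdeal, ← PadicInt.ker_toZMod,
      RingHom.mem_ker, map_sub, hz, map_one, sub_self]
  have : ∀ a : ZMod 3, a ≠ 0 → a = 1 ∨ -a = 1 := by decide
  rcases this _ hne with h | h
  · obtain ⟨w, hw⟩ := PadicInt.exists_sq_eq_of_norm_sub_one_lt (by decide) (hlt _ h)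
    exact ⟨w, .inl hw⟩
  · obtain ⟨w, hw⟩ := PadicInt.exists_sq_eq_of_norm_sub_one_lt (by decide)
      (hlt (-u) (by rw [map_neg, h]))
    exact ⟨w, .inr hw⟩

/-- Square classes of `ℚ_3`. -/
theorem Padic.exists_eq_mul_sq (d : ℚ_[3]) :
    ∃ c w : ℚ_[3], d = c * w ^ 2 ∧ (c = 1 ∨ c = -1 ∨ c = 3 ∨ c = -3) := by
  rcases eq_or_ne d 0 with rfl | hd
  · exact ⟨1, 0, by simp, .inl rfl⟩
  have h3 : (3 : ℚ_[3]) ≠ 0 := by norm_num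
  set n := d.valuation with hn
  have hnorm : ‖d * (3 : ℚ_[3]) ^ (-n)‖ = 1 := by
    have := Padic.norm_p_zpow (p := 3) (-n)
    push_cast at this
    rw [norm_mul, Padic.norm_eq_zpow_neg_valuation hd, this, ← hn]
    push_cast
    rw [← zpow_add₀ (by norm_num)]
    simp
  let u : ℤ_[3] := ⟨_, hnorm.le⟩
  have hu : IsUnit u := PadicInt.isUnit_iff.2 hnorm
  have hdu : d = (u : ℚ_[3]) * 3 ^ n := by
    simp only [u]
    rw [mul_assoc, ← zpow_add₀ h3]; simp
  obtain ⟨w, hw⟩ := PadicInt.exists_sq_eq_or_neg_of_isUnit hu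
  obtain ⟨ε, hε, hεw⟩ : ∃ ε : ℚ_[3], (ε = 1 ∨ ε = -1) ∧ (u : ℚ_[3]) = ε * (w : ℚ_[3]) ^ 2 := by
    rcases hw with hw | hw
    · exact ⟨1, .inl rfl, by rw [← hw]; push_cast; ring⟩
    · have hw' : u = -w ^ 2 := by rw [hw, neg_neg]
      exact ⟨-1, .inr rfl, by rw [hw']; push_cast; ring⟩
  rcases Int.even_or_odd' n with ⟨m, hm | hm⟩
  · refine ⟨ε, w * 3 ^ m, ?_, by tauto⟩
    rw [hdu, hεw, hm, two_mul, zpow_add₀ h3]; ring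
  · refine ⟨ε * 3, w * 3 ^ m, ?_, ?_⟩
    · rw [hdu, hεw, hm, two_mul, zpow_add₀ h3, zpow_add₀ h3, zpow_one]; ring
    · rcases hε with rfl | rfl
      · simp
      · simp

section

variable {E : Type*} [Field E] [Algebra ℚ_[3] E]

variable (E) in
theorem exists_sq_eq_neg_two : ∃ w : E, w ^ 2 = -2 := by
  obtain ⟨w, hw⟩ := PadicInt.exists_sq_eq_neg_two
  let f : ℤ_[3] →+* E := (algebraMap ℚ_[3] E).comp PadicInt.Coe.ringHom
  exact ⟨f w, by rw [← map_pow, hw, map_neg, map_ofNat]⟩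

-- Since `-2` is a square, `2` and `-1` lie in the same square class.
variable (E) in
theorem exists_sq_eq_two_iff_exists_sq_eq_neg_one :
    (∃ s : E, s ^ 2 = 2) ↔ ∃ s : E, s ^ 2 = -1 := by
  have : CharZero E := charZero_of_injective_algebraMap (algebraMap ℚ_[3] E).injective
  obtain ⟨w, hw⟩ := exists_sq_eq_neg_two E
  constructor
  · rintro ⟨s, hs⟩
    refine ⟨s / w, ?_⟩
    rw [div_pow, hs, hw]
    norm_num
  · rintro ⟨s, hs⟩
    exact ⟨s * w, by rw [mul_pow, hs, hw]; norm_num⟩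

/-- The quadratic field is generated by a square root of one of the representatives `1, -1, 3, -3`
of the square classes; `1` generates nothing and `-1` is excluded by `hi`. -/
theorem exists_sq_eq_three_or_neg_three (F : IntermediateField ℚ_[3] E)
    (hF : Module.finrank ℚ_[3] F = 2) (hi : ¬ ∃ s : E, s ^ 2 = -1) :
    ∃ s : E, s ^ 2 = 3 ∨ s ^ 2 = -3 := by
  obtain ⟨y, d, hyd, hy⟩ := exists_sq_eq_algebraMap_of_finrank_eq_two two_ne_zero hF
  obtain ⟨c, w, rfl, hc⟩ := Padic.exists_eq_mul_sq d
  have hw : w ≠ 0 := by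
    rintro rfl
    refine hy ⟨0, ?_⟩
    have : y ^ 2 = 0 := by rw [hyd]; simp
    rw [map_zero, pow_eq_zero_iff two_ne_zero] at *
    exact this.symm
  have hw' : algebraMap ℚ_[3] F w ≠ 0 := by simpa using hw
  have hz : (y / algebraMap ℚ_[3] F w) ^ 2 = algebraMap ℚ_[3] F c := by
    rw [div_pow, hyd, map_mul, map_pow]
    field_simp
  have hzE : ((y / algebraMap ℚ_[3] F w : F) : E) ^ 2 = algebraMap ℚ_[3] E c :=
    congrArg (algebraMap F E) hz
  rcases hc with rfl | rfl | rfl | rfl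
  · exfalso
    rw [map_one, sq_eq_one_iff] at hz
    rcases hz with hz | hz
    · exact hy ⟨w, by rwa [div_eq_one_iff_eq hw', eq_comm] at hz⟩
    · refine hy ⟨-w, ?_⟩
      rw [div_eq_iff hw'] at hz
      rw [hz, map_neg, neg_one_mul]
  · exact absurd ⟨_, by simpa using hzE⟩ hi
  · exact ⟨_, .inl (by rw [hzE, map_ofNat])⟩
  · exact ⟨_, .inr (by rw [hzE, map_neg, map_ofNat])⟩

end

/-! ### Explicit pairs and diagonalization -/

namespace DicyclicPair

section CommRing

variable {A : Type*} [CommRing A]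

/-- The first matrix is the companion matrix of `X ^ 2 - X + 1`. The second has the general shape
satisfying `P R = (1 - R) P`, and its square is the scalar `a ^ 2 - a b + b ^ 2`. -/
theorem of_norm_form {a b : A} (h : a ^ 2 - a * b + b ^ 2 = -1) :
    DicyclicPair !![0, -1; 1, 1] !![a, b; b - a, -a] := by
  refine ⟨?_, ?_, ?_⟩ <;> rw [← sub_eq_zero] <;> ext i j <;> fin_cases i <;> fin_cases j <;>
    simp [Matrix.mul_apply, Matrix.sub_apply, Matrix.one_apply] <;> grind

/-- Here `q` is the symmetric traceless matrix with rows `(a, b)` and `(b, -a)`: its square is `a ^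
2 + b ^ 2`, and it anticommutes with the quarter turn. -/
theorem of_sum_two_squares {a b h : A} (hh : 2 * h = 1) (hab : a ^ 2 + b ^ 2 = -3) :
    DicyclicPair !![h * (1 + a), h * b; h * b, h * (1 - a)] !![0, -1; 1, 0] := by
  refine ⟨?_, ?_, ?_⟩ <;> rw [← sub_eq_zero] <;> ext i j <;> fin_cases i <;> fin_cases j <;>
    simp [Matrix.mul_apply, Matrix.sub_apply, Matrix.one_apply]
  all_goals grind

/-- Here `q` is antidiagonal with entries `β` and `γ`, and `h` is `1 / 2`. -/
theorem of_diagonal {h s β γ : A} (hh : 2 * h = 1) (hs : s ^ 2 = -1) (hβγ : β * γ = -3) :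
    DicyclicPair !![h, h * β; h * γ, h] !![s, 0; 0, -s] := by
  refine ⟨?_, ?_, ?_⟩ <;> rw [← sub_eq_zero] <;> ext i j <;> fin_cases i <;> fin_cases j <;>
    simp [Matrix.mul_apply, Matrix.sub_apply, Matrix.one_apply]
  all_goals grind

/-- The shape of a pair whose second matrix is diagonal. -/
theorem eq_of_diagonal {h s : A} (hh : 2 * h = 1) (hs : s ^ 2 = -1) {R : Matrix (Fin 2) (Fin 2) A}
    (H : DicyclicPair R !![s, 0; 0, -s]) :
    ∃ β γ, β * γ = -3 ∧ R = !![h, h * β; h * γ, h] := by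
  have h1 := congr($H.p_mul_r 0 0)
  have h2 := congr($H.p_mul_r 1 1)
  have h3 := congr($H.r_sq 0 0)
  simp [Matrix.mul_apply, Fin.sum_univ_two, Matrix.sub_apply] at h1 h2 h3
  have h00 : R 0 0 = h := by
    linear_combination (-R 0 0) * hh - h * s * h1 + h * (2 * R 0 0 - 1) * hs
  have h11 : R 1 1 = h := by
    linear_combination (-R 1 1) * hh - h * s * h2 + h * (2 * R 1 1 - 1) * hs
  refine ⟨2 * R 0 1, 2 * R 1 0, ?_, ?_⟩
  · rw [h00] at h3
    linear_combination 4 * h3 - (2 * h - 1) * hh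
  · ext i j
    fin_cases i <;> fin_cases j
    · simpa using h00
    · simp; linear_combination (-R 0 1) * hh
    · simp; linear_combination (-R 1 0) * hh
    · simpa using h11

/-- From `R P R = P` one gets `tr (P R) = 2 tr P`, and from `P R = P - R P` one gets `2 tr (P R) =
tr P`; hence `3 tr P = 0`. -/
theorem trace_p_eq_zero [IsDomain A] [CharZero A] {R P : Matrix (Fin 2) (Fin 2) A}
    (h : DicyclicPair R P) : P.trace = 0 := by
  have h1 : R * P * R = P := by
    rw [mul_assoc, h.p_mul_r, ← mul_assoc, mul_sub, h.r_sq]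
    simp
  have h2 := congrArg Matrix.trace h1
  rw [mul_assoc, Matrix.trace_mul_comm, mul_assoc, h.r_sq, mul_sub, mul_one,
    Matrix.trace_sub] at h2
  have h3 := congrArg Matrix.trace h.p_mul_r
  rw [sub_mul, one_mul, Matrix.trace_sub, Matrix.trace_mul_comm R] at h3
  have h4 : 3 * P.trace = 0 := by linear_combination -2 * h2 + h3
  exact (mul_eq_zero.1 h4).resolve_left (OfNat.ofNat_ne_zero 3)

/-- If `-1` is a square in a local domain containing `1 / 2`, the second matrix of a pair can be
diagonalized. -/
theorem exists_diagonalization [IsDomain A] [CharZero A] [IsLocalRing A] {h s : A}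
    (hh : 2 * h = 1) (hs : s ^ 2 = -1) {R P : Matrix (Fin 2) (Fin 2) A} (H : DicyclicPair R P) :
    ∃ (S : Matrix (Fin 2) (Fin 2) A) (β γ : A), IsUnit S.det ∧ β * γ = -3 ∧
      S * !![h, h * β; h * γ, h] = R * S ∧ S * !![s, 0; 0, -s] = P * S := by
  have htr := H.trace_p_eq_zero
  rw [Matrix.trace_fin_two] at htr
  obtain ⟨a, b, c, rfl⟩ : ∃ a b c, P = !![a, b; c, -a] := by
    refine ⟨P 0 0, P 0 1, P 1 0, ?_⟩
    rw [← eq_neg_of_add_eq_zero_right htr]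
    exact Matrix.eta_fin_two P
  have habc : a ^ 2 + b * c = -1 := by
    have := congr($H.p_sq 0 0)
    simp [Matrix.mul_apply, Fin.sum_univ_two] at this
    linear_combination this
  obtain ⟨S, hS, hSP⟩ : ∃ S : Matrix (Fin 2) (Fin 2) A, IsUnit S.det ∧
      S * !![s, 0; 0, -s] = !![a, b; c, -a] * S := by
    -- The columns of `S` are to be eigenvectors of `P` for `s` and `-s`. The two candidates below
    -- have determinants `-2 s (a + s)` and `2 s (s - a)`; as the sum here is `2 s ^ 2 = -2`, a
    -- unit, locality makes one of them invertible.
    have hu : IsUnit (s * (a + s) + s * (s - a)) := by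
      refine .of_mul_eq_one (-h) ?_
      linear_combination (-2 * h) * hs + hh
    rcases IsLocalRing.isUnit_or_isUnit_of_isUnit_add hu with hu | hu
    · refine ⟨!![a + s, b; c, -(a + s)], ?_, ?_⟩
      · rw [Matrix.det_fin_two_of]
        have : (a + s) * -(a + s) - b * c = -2 * (s * (a + s)) := by
          linear_combination hs - habc
        rw [this]
        exact (IsUnit.of_mul_eq_one (-h) (by linear_combination hh)).mul hu
      · rw [← sub_eq_zero]
        ext i j
        fin_cases i <;> fin_cases j <;> simp <;> grind
    · refine ⟨!![b, a - s; s - a, c], ?_, ?_⟩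
      · rw [Matrix.det_fin_two_of]
        have : b * c - (a - s) * (s - a) = 2 * (s * (s - a)) := by
          linear_combination habc - hs
        rw [this]
        exact (IsUnit.of_mul_eq_one h (by linear_combination hh)).mul hu
      · rw [← sub_eq_zero]
        ext i j
        fin_cases i <;> fin_cases j <;> simp <;> grind
  obtain ⟨g, rfl⟩ := (Matrix.isUnit_iff_isUnit_det S).2 hS
  have hconj := H.conj g⁻¹
  rw [inv_inv, Matrix.mul_assoc _ !![a, b; c, -a], ← hSP, Units.inv_mul_cancel_left] at hconj
  obtain ⟨β, γ, hβγ, hR⟩ := hconj.eq_of_diagonal hh hs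
  refine ⟨g.1, β, γ, hS, hβγ, ?_, hSP⟩
  rw [← hR, Matrix.mul_assoc, Units.mul_inv_cancel_left]

/-- Intertwiners of diagonalized pairs. -/
theorem exists_intertwining_iff [IsDomain A] {h s β γ β' γ' : A} (hh : 2 * h = 1)
    (hs : s ^ 2 = -1) (hβγ : β * γ = -3) (hβγ' : β' * γ' = -3) (h3 : (3 : A) ≠ 0) :
    (∃ S : Matrix (Fin 2) (Fin 2) A, IsUnit S.det ∧
      S * !![h, h * β; h * γ, h] = !![h, h * β'; h * γ', h] * S ∧
      S * !![s, 0; 0, -s] = !![s, 0; 0, -s] * S) ↔ Associated β β' := by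
  constructor
  · rintro ⟨S, hS, hR, hP⟩
    have h01 := congr($hP 0 1)
    have h10 := congr($hP 1 0)
    have hR01 := congr($hR 0 1)
    simp [Matrix.mul_apply, Fin.sum_univ_two] at h01 h10 hR01
    -- Commuting with `diag(s, -s)`, where `2 s` is a unit, forces `S` to be diagonal.
    have e01 : S 0 1 = 0 := by
      linear_combination (h * s) * h01 - S 0 1 * hh + 2 * h * S 0 1 * hs
    have e10 : S 1 0 = 0 := by
      linear_combination -(h * s) * h10 - S 1 0 * hh + 2 * h * S 1 0 * hs
    rw [Matrix.det_fin_two, e01, zero_mul, sub_zero] at hS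
    obtain ⟨u, hu⟩ := isUnit_of_mul_isUnit_left hS
    obtain ⟨v, hv⟩ := isUnit_of_mul_isUnit_right hS
    rw [e01, ← hu, ← hv] at hR01
    refine ⟨u * v⁻¹, ?_⟩
    have : β * u = β' * v := by
      linear_combination 2 * hR01 + (β' * v - β * u) * hh
    rw [Units.val_mul, ← mul_assoc, this, Units.mul_inv_cancel_right]
  · rintro ⟨u, rfl⟩
    have hγ : γ' * u = γ := by
      have hβ : β ≠ 0 := by
        rintro rfl
        rw [zero_mul, eq_comm, neg_eq_zero] at hβγ
        exact h3 hβγ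
      refine mul_left_cancel₀ hβ ?_
      linear_combination hβγ' - hβγ
    refine ⟨!![(u : A), 0; 0, 1], by simp [Matrix.det_fin_two_of], ?_, ?_⟩ <;>
    · rw [← sub_eq_zero]
      ext i j
      fin_cases i <;> fin_cases j <;> simp [← hγ] <;> ring

end CommRing

end DicyclicPair

/-- Two surjections from `T` with the same fibres have equinumerous targets. Below, `T` is the set
of factorizations of `-3`. -/
theorem ENat.card_eq_card_add_one {T A B : Type*} {f : T → A} {g : T → Option B}
    (hf : Function.Surjective f) (hg : Function.Surjective g)
    (h : ∀ s t, f s = f t ↔ g s = g t) : ENat.card A = ENat.card B + 1 := by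
  have hker : Setoid.ker f = Setoid.ker g := Setoid.ext h
  rw [← ENat.card_congr (Setoid.quotientKerEquivOfSurjective f hf), hker,
    ENat.card_congr (Setoid.quotientKerEquivOfSurjective g hg),
    ENat.card_congr (Equiv.optionEquivSumPUnit.{0} B), ENat.card_sum]
  simp

/-! ### Divisors of `3` and the ramification index -/

section Ramification

variable {p : ℕ} [Fact p.Prime] {E : Type*} [Field E] [Algebra ℚ_[p] E]

theorem associated_localIntegers_iff
    [Algebra.IsAlgebraic ℚ_[p] E] {x y : localIntegers p E} (hx : x ≠ 0) (hy : y ≠ 0) :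
    Associated x y ↔ spectralNorm ℚ_[p] E x = spectralNorm ℚ_[p] E y := by
  constructor
  · rintro ⟨u, rfl⟩
    rw [Subring.coe_mul, padic_spectralNorm_mul, isUnit_localIntegers_iff.1 u.isUnit, mul_one]
  · intro h
    have hx' : (x : E) ≠ 0 := by simpa using hx
    have hn := padic_spectralNorm_ne_zero (p := p) hx'
    have h1 : spectralNorm ℚ_[p] E ((x : E)⁻¹ * y) = 1 := by
      rw [padic_spectralNorm_mul, padic_spectralNorm_inv, ← h, inv_mul_cancel₀ hn]
    obtain ⟨u, hu⟩ := exists_unit_localIntegers_eq h1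
    refine ⟨u, Subtype.ext ?_⟩
    rw [Subring.coe_mul, hu, mul_inv_cancel_left₀ hx']

variable (p E) in
/-- The subgroup of `Eˣ` generated by the units of the ring of integers and by `ℚ_pˣ`. -/
noncomputable abbrev localUnramifiedSubgroup : Subgroup Eˣ :=
  (Units.map (localIntegers p E).subtype.toMonoidHom).range ⊔
    (Units.map (algebraMap ℚ_[p] E).toMonoidHom).range

/-- This turns the quotient defining the ramification index into the value group modulo the powers
of `p`. -/
theorem mem_localUnramifiedSubgroup_iff
    [Algebra.IsAlgebraic ℚ_[p] E] {x : Eˣ} :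
    x ∈ localUnramifiedSubgroup p E ↔ ∃ n : ℤ, spectralNorm ℚ_[p] E x = (p : ℝ) ^ n := by
  have hp : (p : ℝ) ≠ 0 := Nat.cast_ne_zero.2 (Fact.out : p.Prime).ne_zero
  rw [Subgroup.mem_sup]
  constructor
  · rintro ⟨_, ⟨u, rfl⟩, _, ⟨c, rfl⟩, rfl⟩
    refine ⟨-(c : ℚ_[p]).valuation, ?_⟩
    rw [← Padic.norm_eq_zpow_neg_valuation c.ne_zero, Units.val_mul, padic_spectralNorm_mul]
    have h1 : spectralNorm ℚ_[p] E (u.1 : E) = 1 := isUnit_localIntegers_iff.1 u.isUnit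
    have h2 : spectralNorm ℚ_[p] E (algebraMap ℚ_[p] E c) = ‖(c : ℚ_[p])‖ := spectralNorm_extends _
    exact (congrArg₂ _ h1 h2).trans (one_mul _)
  · rintro ⟨n, hn⟩
    have hp' : (p : ℚ_[p]) ≠ 0 := Nat.cast_ne_zero.2 (Fact.out : p.Prime).ne_zero
    let c : ℚ_[p]ˣ := Units.mk0 ((p : ℚ_[p]) ^ (-n)) (zpow_ne_zero _ hp')
    have hc : spectralNorm ℚ_[p] E (algebraMap ℚ_[p] E c) = (p : ℝ) ^ n := by
      rw [spectralNorm_extends]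
      simp [c]
    let d : Eˣ := Units.map (algebraMap ℚ_[p] E).toMonoidHom c
    have hd : spectralNorm ℚ_[p] E d = (p : ℝ) ^ n := hc
    have h1 : spectralNorm ℚ_[p] E ((x * d⁻¹ : Eˣ) : E) = 1 := by
      rw [Units.val_mul, padic_spectralNorm_mul, Units.val_inv_eq_inv_val, padic_spectralNorm_inv,
        hd, hn, mul_inv_cancel₀ (zpow_ne_zero _ hp)]
    obtain ⟨u, hu⟩ := exists_unit_localIntegers_eq h1
    exact ⟨x * d⁻¹, ⟨u, Units.ext hu⟩, d, ⟨c, rfl⟩, inv_mul_cancel_right _ _⟩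

end Ramification

section Ramification

variable {E : Type*} [Field E] [Algebra ℚ_[3] E]

theorem spectralNorm_three : spectralNorm ℚ_[3] E 3 = 3⁻¹ := by
  have h : ‖(3 : ℚ_[3])‖ = 3⁻¹ := by simpa using Padic.norm_p (p := 3)
  rw [← h, ← spectralNorm_extends (L := E), map_ofNat]

variable [Algebra.IsAlgebraic ℚ_[3] E]

/-- A class modulo `O_Eˣ ℚ_3ˣ` is represented by exactly one divisor class `β` of `3` with
`‖3‖ < ‖β‖`, and one divisor class of `3` remains. -/
theorem exists_surjective_option_ramification :
    ∃ g : {x : localIntegers 3 E × localIntegers 3 E // x.1 * x.2 = -3} →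
        Option (Eˣ ⧸ localUnramifiedSubgroup 3 E),
      Function.Surjective g ∧ ∀ s t, g s = g t ↔ Associated s.1.1 t.1.1 := by
  classical
  have : CharZero E := charZero_of_injective_algebraMap (algebraMap ℚ_[3] E).injective
  have hE3 : (3 : E) ≠ 0 := by norm_num
  have hmul : ∀ t : {x : localIntegers 3 E × localIntegers 3 E // x.1 * x.2 = -3},
      (t.1.1 : E) * t.1.2 = -3 := fun t => congrArg Subtype.val t.2
  have hne : ∀ t : {x : localIntegers 3 E × localIntegers 3 E // x.1 * x.2 = -3},
      (t.1.1 : E) ≠ 0 := by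
    intro t ht
    have := hmul t
    rw [ht, zero_mul, eq_comm, neg_eq_zero] at this
    exact hE3 this
  have hle : ∀ t : {x : localIntegers 3 E × localIntegers 3 E // x.1 * x.2 = -3},
      spectralNorm ℚ_[3] E t.1.1 ≤ 1 := fun t => mem_localIntegers_iff.1 t.1.1.2
  have hge : ∀ t : {x : localIntegers 3 E × localIntegers 3 E // x.1 * x.2 = -3},
      3⁻¹ ≤ spectralNorm ℚ_[3] E t.1.1 := by
    intro t
    have := congrArg (spectralNorm ℚ_[3] E) (hmul t)
    rw [padic_spectralNorm_mul, spectralNorm_neg (Algebra.IsAlgebraic.isAlgebraic _),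
      spectralNorm_three] at this
    rw [← this]
    exact mul_le_of_le_one_right (spectralNorm_nonneg _) (mem_localIntegers_iff.1 t.1.2.2)
  -- The norms of `β` fill `[1/3, 1]`. The endpoints `1/3` and `1` agree modulo powers of `3`, so
  -- the lower one is sent to `none`; this is the extra form.
  refine ⟨fun t => if spectralNorm ℚ_[3] E t.1.1 = 3⁻¹ then none else
    some (Units.mk0 (t.1.1 : E) (hne t) : Eˣ ⧸ localUnramifiedSubgroup 3 E), ?_, ?_⟩
  · rintro (_ | x)
    · exact ⟨⟨(3, -1), by ring⟩, if_pos spectralNorm_three⟩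
    · obtain ⟨x, rfl⟩ := QuotientGroup.mk_surjective x
      have hx0 := padic_spectralNorm_ne_zero (p := 3) x.ne_zero
      have hxpos : 0 < spectralNorm ℚ_[3] E (x : E) := lt_of_le_of_ne (spectralNorm_nonneg _) hx0.symm
      -- With `3 ^ n < ‖x‖ ≤ 3 ^ (n + 1)`, multiplication by `3 ^ (n + 1)` brings the norm into
      -- `(1/3, 1]`.
      obtain ⟨n, hn1, hn2⟩ := exists_mem_Ioc_zpow hxpos (by norm_num : (1 : ℝ) < 3)
      let y : E := x * 3 ^ (n + 1)
      have h3n : spectralNorm ℚ_[3] E (3 ^ (n + 1)) = ((3 : ℝ) ^ (n + 1))⁻¹ := by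
        have : spectralNorm ℚ_[3] E (algebraMap ℚ_[3] E (3 ^ (n + 1))) = ((3 : ℝ) ^ (n + 1))⁻¹ := by
          rw [spectralNorm_extends, ← zpow_neg]
          simpa using Padic.norm_p_zpow (p := 3) (n + 1)
        rwa [map_zpow₀, map_ofNat] at this
      have hy : spectralNorm ℚ_[3] E y = spectralNorm ℚ_[3] E (x : E) * ((3 : ℝ) ^ (n + 1))⁻¹ := by
        rw [padic_spectralNorm_mul, h3n]
      have h3pos : (0 : ℝ) < 3 ^ (n + 1) := by positivity
      have hy1 : spectralNorm ℚ_[3] E y ≤ 1 := by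
        rw [hy, ← div_eq_mul_inv, div_le_one h3pos]
        exact hn2
      have hy2 : 3⁻¹ < spectralNorm ℚ_[3] E y := by
        rw [hy, ← div_eq_mul_inv, lt_div_iff₀ h3pos, zpow_add_one₀ (by norm_num)]
        linarith
      have hy0 : y ≠ 0 := mul_ne_zero x.ne_zero (zpow_ne_zero _ hE3)
      have hz : spectralNorm ℚ_[3] E (-3 * y⁻¹) ≤ 1 := by
        rw [padic_spectralNorm_mul, spectralNorm_neg (Algebra.IsAlgebraic.isAlgebraic _),
          spectralNorm_three, padic_spectralNorm_inv, ← div_eq_mul_inv,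
          div_le_one (lt_trans (by norm_num) hy2)]
        exact hy2.le
      refine ⟨⟨(⟨y, mem_localIntegers_iff.2 hy1⟩, ⟨_, mem_localIntegers_iff.2 hz⟩),
        Subtype.ext ?_⟩, ?_⟩
      · change y * (-3 * y⁻¹) = -3
        field_simp
      · refine (if_neg hy2.ne').trans (congrArg some ?_)
        refine QuotientGroup.eq.2 (mem_localUnramifiedSubgroup_iff.2 ⟨n + 1, ?_⟩)
        rw [Units.val_mul, Units.val_inv_eq_inv_val, Units.val_mk0, padic_spectralNorm_mul,
          padic_spectralNorm_inv, hy]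
        push_cast
        field_simp
  · intro s t
    rw [associated_localIntegers_iff (fun h => hne s (congrArg Subtype.val h))
      (fun h => hne t (congrArg Subtype.val h))]
    have hs0 := padic_spectralNorm_ne_zero (p := 3) (hne s)
    constructor
    · intro h
      dsimp only at h
      split_ifs at h with h1 h2 h2
      · rw [h1, h2]
      · have h := QuotientGroup.eq.1 (Option.some.inj h)
        obtain ⟨n, hn⟩ := mem_localUnramifiedSubgroup_iff.1 h
        rw [Units.val_mul, Units.val_inv_eq_inv_val, Units.val_mk0, Units.val_mk0,
          padic_spectralNorm_mul, padic_spectralNorm_inv] at hn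
        push_cast at hn
        have hs1 := lt_of_le_of_ne (hge s) (Ne.symm h1)
        have ht1 := lt_of_le_of_ne (hge t) (Ne.symm h2)
        have hspos : 0 < spectralNorm ℚ_[3] E s.1.1 := lt_trans (by norm_num) hs1
        have ht : spectralNorm ℚ_[3] E t.1.1 = spectralNorm ℚ_[3] E s.1.1 * 3 ^ n := by
          rw [← hn, mul_inv_cancel_left₀ hs0]
        -- Both norms lie in `(1/3, 1]` and their ratio is `3 ^ n`, so `n = 0`.
        have hn1 : (3 : ℝ) ^ n < 3 ^ (1 : ℤ) := by
          have := hle t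
          rw [ht] at this
          rw [zpow_one]
          nlinarith
        have hn2 : (3 : ℝ) ^ (-1 : ℤ) < 3 ^ n := by
          rw [ht] at ht1
          rw [zpow_neg_one]
          have : (0 : ℝ) < 3 ^ n := by positivity
          nlinarith [hle s]
        rw [zpow_lt_zpow_iff_right₀ (by norm_num)] at hn1 hn2
        have : n = 0 := by omega
        rw [ht, this, zpow_zero, mul_one]
    · intro h
      dsimp only
      rw [h]
      split_ifs with h1
      · rfl
      · refine congrArg some (QuotientGroup.eq.2 (mem_localUnramifiedSubgroup_iff.2 ⟨0, ?_⟩))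
        rw [Units.val_mul, Units.val_inv_eq_inv_val, Units.val_mk0, Units.val_mk0,
          padic_spectralNorm_mul, padic_spectralNorm_inv, ← h, inv_mul_cancel₀ hs0, zpow_zero]

end Ramification

/-! ### The two cases of the theorem -/

section Main

theorem exists_two_mul_eq_one_localIntegers (E : Type*) [Field E] [Algebra ℚ_[3] E]
    [Algebra.IsAlgebraic ℚ_[3] E] : ∃ h : localIntegers 3 E, 2 * h = 1 := by
  have : IsUnit ((2 : ℕ) : localIntegers 3 E) := isUnit_natCast_localIntegers (by decide)
  exact this.exists_right_inv

/-- Factorizations `β γ = -3` map onto the forms by diagonalization. Two of them give the same form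
exactly when their `β` are associated, which are also the fibres of the map to classes of the value
group with one point added. -/
theorem card_integralForms_eq_ramificationIndex_add_one {E : Type*} [Field E] [Algebra ℚ E]
    [Algebra ℚ_[3] E] [Algebra.IsAlgebraic ℚ_[3] E] (hi : ∃ s : E, s ^ 2 = -1)
    (φ : (E ⊗[ℚ] ℍ[ℚ, -3, -1]) ≃ₐ[E] Matrix (Fin 2) (Fin 2) E) :
    ENat.card (IntegralForms (localIntegers 3 E) (dicyclicRep φ)) =
      localRamificationIndex 3 E + 1 := by
  have : CharZero E := algebraRat.charZero E
  obtain ⟨g, hg, hgker⟩ := exists_surjective_option_ramification (E := E)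
  obtain ⟨h, hh⟩ := exists_two_mul_eq_one_localIntegers E
  obtain ⟨s, hs⟩ : ∃ s : localIntegers 3 E, s ^ 2 = -1 := by
    obtain ⟨s, hs⟩ := hi
    have hsO : s ∈ localIntegers 3 E := by
      have h1 : spectralNorm ℚ_[3] E s * spectralNorm ℚ_[3] E s = 1 := by
        rw [← padic_spectralNorm_mul, ← sq, hs,
          spectralNorm_neg (Algebra.IsAlgebraic.isAlgebraic _), spectralNorm_one]
      rw [mem_localIntegers_iff]
      nlinarith [spectralNorm_nonneg (K := ℚ_[3]) s]
    exact ⟨⟨s, hsO⟩, Subtype.ext hs⟩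
  have h3 : (3 : localIntegers 3 E) ≠ 0 := OfNat.ofNat_ne_zero 3
  choose f hfr hfp using fun t : {x : localIntegers 3 E × localIntegers 3 E // x.1 * x.2 = -3} =>
    (DicyclicPair.of_diagonal hh hs t.2).exists_integralRep φ
  refine ENat.card_eq_card_add_one
    (f := fun t => (Quotient.mk _ (f t) : IntegralForms (localIntegers 3 E) (dicyclicRep φ)))
    ?_ hg fun x y => ?_
  · intro σ
    induction σ using Quotient.inductionOn with | _ σ
    obtain ⟨S, β, γ, hS, hβγ, hR, hP⟩ := σ.dicyclicPair.exists_diagonalization hh hs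
    refine ⟨⟨(β, γ), hβγ⟩, Quotient.sound (integralRepSetoid_of_intertwining hS ?_ ?_)⟩
    · rw [hfr]; exact hR
    · rw [hfp]; exact hP
  · rw [hgker, ← DicyclicPair.exists_intertwining_iff hh hs x.2 y.2 h3]
    refine Quotient.eq.trans ⟨fun H => ?_, fun ⟨S, hS, hR, hP⟩ => ?_⟩
    · have := exists_intertwining_of_integralRepSetoid H
      rwa [hfr, hfr, hfp, hfp] at this
    · refine integralRepSetoid_of_intertwining hS ?_ ?_
      · rw [hfr, hfr]; exact hR
      · rw [hfp, hfp]; exact hP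

theorem exists_dicyclicPair_localIntegers_three {E : Type*} [Field E] [Algebra ℚ_[3] E]
    [Algebra.IsAlgebraic ℚ_[3] E] (F : IntermediateField ℚ_[3] E)
    (hF : Module.finrank ℚ_[3] F = 2) :
    ∃ R P : Matrix (Fin 2) (Fin 2) (localIntegers 3 E), DicyclicPair R P := by
  obtain ⟨h, hh⟩ := exists_two_mul_eq_one_localIntegers E
  suffices H : ∃ a b : E, a ^ 2 + b ^ 2 = -3 ∧ a ∈ localIntegers 3 E ∧ b ∈ localIntegers 3 E by
    obtain ⟨a, b, hab, ha, hb⟩ := H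
    exact ⟨_, _, .of_sum_two_squares (a := ⟨a, ha⟩) (b := ⟨b, hb⟩) hh (Subtype.ext hab)⟩
  have hmem : ∀ (a : E) (c : localIntegers 3 E), a ^ 2 = c → a ∈ localIntegers 3 E := by
    intro a c hac
    have h1 := mem_localIntegers_iff.1 c.2
    rw [← hac, sq, padic_spectralNorm_mul] at h1
    rw [mem_localIntegers_iff]
    nlinarith [spectralNorm_nonneg (K := ℚ_[3]) a]
  -- With `w ^ 2 = -2`, the value `-3` is `-1 + w ^ 2` if `-1` is a square, `s ^ 2 + (s w) ^ 2 = 3 -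
  -- 6` if `s ^ 2 = 3`, and `s ^ 2 + 0` if `s ^ 2 = -3`.
  obtain ⟨w, hw⟩ := exists_sq_eq_neg_two E
  by_cases hi : ∃ s : E, s ^ 2 = -1
  · obtain ⟨s, hs⟩ := hi
    exact ⟨s, w, by rw [hs, hw]; norm_num, hmem s (-1) hs, hmem w (-2) hw⟩
  · obtain ⟨s, hs | hs⟩ := exists_sq_eq_three_or_neg_three F hF hi
    · refine ⟨s, s * w, ?_, hmem s 3 hs, hmem _ (-6) ?_⟩
      · rw [mul_pow, hs, hw]; norm_num
      · rw [mul_pow, hs, hw]; norm_num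
        rfl
    · exact ⟨s, 0, by rw [hs]; norm_num, hmem s (-3) hs, zero_mem _⟩

theorem theorem4 :
    (∀ (E : Type*) [Field E] [Algebra ℚ E] [Algebra ℚ_[3] E],
      IsGalois ℚ_[3] E →
      (∃ F : IntermediateField ℚ_[3] E, Module.finrank ℚ_[3] F = 2) →
      Nonempty ((E ⊗[ℚ] ℍ[ℚ, -3, -1]) ≃ₐ[E] Matrix (Fin 2) (Fin 2) E) ∧
      ∀ φ : (E ⊗[ℚ] ℍ[ℚ, -3, -1]) ≃ₐ[E] Matrix (Fin 2) (Fin 2) E,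
        ((∃ s : E, s ^ 2 = 2) →
          ENat.card (IntegralForms (localIntegers 3 E) (dicyclicRep φ)) =
            localRamificationIndex 3 E + 1) ∧
        ((¬ ∃ s : E, s ^ 2 = 2) →
          ENat.card (IntegralForms (localIntegers 3 E) (dicyclicRep φ)) = 1)) ∧
    (∀ (p : ℕ) [Fact p.Prime], p ≠ 3 →
      ∀ (E : Type*) [Field E] [Algebra ℚ E] [Algebra ℚ_[p] E],
      Algebra.IsAlgebraic ℚ_[p] E →
      Nonempty ((E ⊗[ℚ] ℍ[ℚ, -3, -1]) ≃ₐ[E] Matrix (Fin 2) (Fin 2) E) ∧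
      ∀ φ : (E ⊗[ℚ] ℍ[ℚ, -3, -1]) ≃ₐ[E] Matrix (Fin 2) (Fin 2) E,
        ENat.card (IntegralForms (localIntegers p E) (dicyclicRep φ)) = 1) := by
  refine ⟨fun E _ _ _ _ ⟨F, hF⟩ => ?_, fun p _ hp E _ _ _ _ => ?_⟩
  · obtain ⟨R, P, h⟩ := exists_dicyclicPair_localIntegers_three F hF
    refine ⟨(h.map (localIntegers 3 E).subtype).nonempty_algEquiv, fun φ => ⟨fun h2 => ?_,
      fun h2 => ?_⟩⟩
    · exact card_integralForms_eq_ramificationIndex_add_one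
        ((exists_sq_eq_two_iff_exists_sq_eq_neg_one E).1 h2) φ
    · refine card_integralForms_eq_one (mem_or_inv_mem_localIntegers 3) (fun _ b hb => h2 ?_) h
      exact (exists_sq_eq_two_iff_exists_sq_eq_neg_one E).2
        (exists_sq_eq_neg_one_of_residueField (by decide) hb)
  · obtain ⟨a, b, hab⟩ := PadicInt.exists_sq_sub_mul_add_sq_eq_neg_one hp
    have h := (DicyclicPair.of_norm_form hab).map (padicIntToLocalIntegers p E)
    refine ⟨(h.map (localIntegers p E).subtype).nonempty_algEquiv, fun φ => ?_⟩
    refine card_integralForms_eq_one (mem_or_inv_mem_localIntegers p) (fun h3 => ?_) h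
    have hu : IsUnit ((3 : ℕ) : localIntegers p E) := isUnit_natCast_localIntegers
      ((Nat.coprime_primes Fact.out Nat.prime_three).2 hp)
    have := (hu.map (IsLocalRing.residue (localIntegers p E))).ne_zero
    rw [map_natCast] at this
    exact absurd (by exact_mod_cast h3) this

end Main
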